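/- Let $\mathcal C$ be a small $\mathbb C$-linear category and $1\le p<\infty$. **Fredholm modules.** A $\mathbb Z_2$-graded separable Hilbert space is a separable complex Hilbert space with a bounded self-adjoint grading operator $\epsilon$, $\epsilon^2=1$; an operator has degree $0$ (degree $1$) if it commutes (anticommutes) with the grading operators. Let $(\mathscr H,\mathcal F)$ be a $p$-summable even Fredholm module over $\mathcal C$: $\mathscr H$ is a $\mathbb C$-linear functor from $\mathcal C$ to the category of $\mathbb Z_2$-graded separable Hilbert spaces and bounded linear maps such that every $\mathscr H(f)$ has degree $0$; $\mathcal F=\{\mathcal F_X\}_{X\in Ob(\mathcal C)}$ is a family of bounded operators of degree $1$ on $\mathscr H(X)$ with $\mathcal F_X^2=id$; and for every $f\in Hom_{\mathcal C}(X,Y)$ the operator $[\mathcal F,f]:=\mathcal F_Y\mathscr H(f)-\mathscr H(f)\mathcal F_X$ lies in the Schatten class $\mathcal B^p(\mathscr H(X),\mathscr H(Y))$, i.e. it is compact and $\sum_n\mu_n^p<\infty$ for its singular values $\mu_n$ (the eigenvalues of $|T|=(T^*T)^{1/2}$ in decreasing order with multiplicity). **The DG-semicategory $\Omega'\mathcal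 C=\Omega_{(\mathscr H,\mathcal F)}\mathcal C$.** Its objects are those of $\mathcal C$. $Hom^j_{\Omega'\mathcal C}(X,Y)$ is the linear span in $\mathcal B(\mathscr H(X),\mathscr H(Y))$ of the operators $(\mathscr H(f^0)+\mu\, id)[\mathcal F,f^1]\cdots[\mathcal F,f^j]$ with $f^0:X_1\to Y$, $f^1:X_2\to X_1$, …, $f^j:X\to X_j$ in $\mathcal C$ and $\mu\in\mathbb C$, where $\mu=0$ if $j=0$ or $X_1\ne Y$ (for $j=0$ these are the operators $\mathscr H(f^0)$, $f^0:X\to Y$). Composition is composition of operators, and $\partial'T=[\mathcal F,T]:=\mathcal F_YT-(-1)^jT\mathcal F_X$ for $T\in Hom^j_{\Omega'\mathcal C}(X,Y)$. Let $\rho':\mathcal C\to\Omega'^0\mathcal C$ be the semifunctor that is the identity on objects and sends $f$ to $\mathscr H(f)$. **Cycles.** A closed graded trace of dimension $n$ on a DG-semicategory $(\mathcal S,\hat\partial)$ is a family of linear maps $\hat T_X:Hom^n_{\mathcal S}(X,X)\to\mathbb C$ with $\hat T_X(\hat\partial f)=0$ for $f\in Hom^{n-1}_{\mathcal S}(X,X)$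 and $\hat T_X(gg')=(-1)^{ij}\hat T_Y(g'g)$ for $g\in Hom^i_{\mathcal S}(Y,X)$, $g'\in Hom^j_{\mathcal S}(X,Y)$, $i+j=n$. An $n$-dimensional cycle over $\mathcal C$ is a tuple $(\mathcal S,\hat\partial,\hat T,\rho)$ where $(\mathcal S,\hat\partial)$ is a ($\mathbb C$-linear) DG-semicategory, $\hat T$ a closed graded trace of dimension $n$ on it and $\rho:\mathcal C\to\mathcal S^0$ a $\mathbb C$-linear semifunctor. Its character is $f^0\otimes\cdots\otimes f^n\mapsto\hat T(\rho(f^0)\hat\partial\rho(f^1)\cdots\hat\partial\rho(f^n))$. **Cyclic cohomology.** Let $CN_n(\mathcal C)=\bigoplus_{(X_0,\dots,X_n)}Hom(X_1,X_0)\otimes Hom(X_2,X_1)\otimes\cdots\otimes Hom(X_0,X_n)$ and $CN^n(\mathcal C)=Hom_{\mathbb C}(CN_n(\mathcal C),\mathbb C)$. For $\phi\in CN^n(\mathcal C)$ put $(b\phi)(f^0\otimes\cdots\otimes f^{n+1})=\sum_{i=0}^n(-1)^i\phi(f^0\otimes\cdots\otimes f^if^{i+1}\otimes\cdots\otimes f^{n+1})+(-1)^{n+1}\phi(f^{n+1}f^0\otimes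 f^1\otimes\cdots\otimes f^n)$ and $(\lambda\phi)(f^0\otimes\cdots\otimes f^n)=(-1)^n\phi(f^n\otimes f^0\otimes\cdots\otimes f^{n-1})$. With $C^n_\lambda=Ker(1-\lambda)$, the cyclic cocycles are $Z^n_\lambda(\mathcal C)=\{\phi\in C^n_\lambda: b\phi=0\}$, the coboundaries are $B^n_\lambda(\mathcal C)=b(C^{n-1}_\lambda)$ (zero for $n=0$), and $H^n_\lambda(\mathcal C)=Z^n_\lambda(\mathcal C)/B^n_\lambda(\mathcal C)$. **Theorem.** Let $m\ge 0$ be an integer with $2m\ge p-1$. Then $\partial'T$ is of trace class for every $T\in Hom^{2m}_{\Omega'\mathcal C}(X,X)$, and the maps $$Tr_s(T):=\tfrac12\,Tr\big(\epsilon\,\mathcal F_X\,\partial'T\big),\qquad T\in Hom^{2m}_{\Omega'\mathcal C}(X,X),\ X\in Ob(\mathcal C),$$ where $Tr(S)=\sum_i\langle e_i,Se_i\rangle$ for an orthonormal basis $(e_i)$ of $\mathscr H(X)$, form a closed graded trace $\hat{Tr}_s$ of dimension $2m$ on $(\Omega'\mathcal C,\partial')$, so that $(\Omega'\mathcal C,\partial',\hat{Tr}_s,\rho')$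 is a $2m$-dimensional cycle over $\mathcal C$. Its character is $$\phi^{2m}(f^0\otimes\cdots\otimes f^{2m})=Tr_s\big(\mathscr H(f^0)[\mathcal F,f^1]\cdots[\mathcal F,f^{2m}]\big),$$ it is a cyclic cocycle, $\phi^{2m}\in Z^{2m}_\lambda(\mathcal C)$, and its class in $H^{2m}_\lambda(\mathcal C)$ is the Chern character $ch^{2m}(\mathscr H,\mathcal F)$ (which is defined as the class of this cocycle). -/

import Mathlib

open CategoryTheory

universe w v u

noncomputable section

namespace FredholmCat

/-! ### Singular values, Schatten classes, trace -/

section Schatten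

variable {E : Type*} [NormedAddCommGroup E] [InnerProductSpace ℂ E] [CompleteSpace E]
variable {G : Type*} [NormedAddCommGroup G] [InnerProductSpace ℂ G] [CompleteSpace G]

/-- `|T| = (T* T)^{1/2}`, the positive square root being taken in the C⋆-algebra of bounded
operators on `E`. -/
def absOp (T : E →L[ℂ] G) : E →L[ℂ] E :=
  CFC.sqrt ((ContinuousLinearMap.adjoint T) ∘L T)

/-- The `n`-th singular value (`n = 0, 1, 2, …`) of a compact operator `T`: the `n`-th eigenvalue
of `|T|` in decreasing order, repeated according to multiplicity. It is the largest `t` such that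
`|T|` has at least `n + 1` eigenvalues `≥ t` counted with multiplicity, that is, `n + 1`
orthonormal eigenvectors with eigenvalues `≥ t` (and it is `0` when `dim E ≤ n`). -/
def singularValue (T : E →L[ℂ] G) (n : ℕ) : ℝ :=
  sSup {t : ℝ | ∃ e : Fin (n + 1) → E, Orthonormal ℂ e ∧
    ∀ i, ∃ s : ℝ, t ≤ s ∧ absOp T (e i) = (s : ℂ) • e i}

/-- Membership in the Schatten class `B^p(E, G)`: the operator is compact and the sum of the
`p`-th powers of its singular values is finite. -/
def IsSchatten (p : ℝ) (T : E →L[ℂ] G) : Prop :=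
  IsCompactOperator T ∧ Summable fun n : ℕ => singularValue T n ^ p

/-- The trace `∑ᵢ ⟨eᵢ, T eᵢ⟩` in an orthonormal Hilbert basis; for trace class operators, i.e.
those in `B^1(E, E)`, the family is summable and the sum does not depend on the basis. -/
def trace (T : E →L[ℂ] E) : ℂ :=
  ∑' i, inner ℂ ((exists_hilbertBasis ℂ E).choose_spec.choose i)
    (T ((exists_hilbertBasis ℂ E).choose_spec.choose i))

end Schatten

/-! ### The category of `ℤ/2`-graded separable Hilbert spaces -/

/-- A `ℤ/2`-graded separable complex Hilbert space. The grading `E = E⁺ ⊕ E⁻` (orthogonal direct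
sum) is recorded by the grading operator `ε`, which is `1` on `E⁺` and `-1` on `E⁻`. -/
structure GradedHilb : Type (w + 1) where
  carrier : Type w
  [normedAddCommGroup : NormedAddCommGroup carrier]
  [innerProductSpace : InnerProductSpace ℂ carrier]
  [completeSpace : CompleteSpace carrier]
  [separableSpace : TopologicalSpace.SeparableSpace carrier]
  ε : carrier →L[ℂ] carrier
  ε_sq : ε ∘L ε = ContinuousLinearMap.id ℂ carrier
  ε_selfAdjoint : IsSelfAdjoint ε

attribute [instance] GradedHilb.normedAddCommGroup GradedHilb.innerProductSpace
  GradedHilb.completeSpace GradedHilb.separableSpace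

/-- The morphisms are all bounded linear maps. -/
instance : Category GradedHilb.{w} where
  Hom E G := E.carrier →L[ℂ] G.carrier
  id E := ContinuousLinearMap.id ℂ E.carrier
  comp S T := T ∘L S

/-- A morphism of graded Hilbert spaces, seen as a bounded operator. -/
def GradedHilb.toOp {E G : GradedHilb.{w}} (T : E ⟶ G) : E.carrier →L[ℂ] G.carrier := T

instance : Preadditive GradedHilb.{w} where
  homGroup E G := inferInstanceAs (AddCommGroup (E.carrier →L[ℂ] G.carrier))
  add_comp _ _ _ S S' T := ContinuousLinearMap.comp_add T S S'
  comp_add _ _ _ S T T' := ContinuousLinearMap.add_comp T T' S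

instance : Linear ℂ GradedHilb.{w} where
  homModule E G := inferInstanceAs (Module ℂ (E.carrier →L[ℂ] G.carrier))
  smul_comp _ _ _ a S T := ContinuousLinearMap.comp_smul T a S
  comp_smul _ _ _ S a T := ContinuousLinearMap.smul_comp a T S

/-! ### Chains of composable morphisms, the cyclic nerve and cyclic cohomology -/

/-- `Chain C n X Y` consists of the tuples `(f⁰, f¹, …, fⁿ⁻¹)` of composable morphisms
`Y ⟵ X₁ ⟵ X₂ ⟵ ⋯ ⟵ Xₙ₋₁ ⟵ X` with `f⁰ : X₁ ⟶ Y` on the left. -/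
inductive Chain (C : Type u) [Category.{v} C] : ℕ → C → C → Type (max u v)
  | nil (X : C) : Chain C 0 X X
  | cons {n : ℕ} {X Y Z : C} (f : Z ⟶ Y) (c : Chain C n X Z) : Chain C (n + 1) X Y

section CyclicNerve

variable {C : Type u} [Category.{v} C]

/-- `(f⁰, …, fⁿ⁺¹) ↦ (f⁰, …, fⁱ ∘ fⁱ⁺¹, …, fⁿ⁺¹)` for `0 ≤ i ≤ n`. -/
def Chain.compAt : {n : ℕ} → {X Y : C} → Fin (n + 1) → Chain C (n + 2) X Y → Chain C (n + 1) X Y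
  | 0, _, _, _, .cons f (.cons g c) => .cons (g ≫ f) c
  | n + 1, _, _, i, .cons f (.cons g c) =>
      Fin.cases (motive := fun _ => Chain C (n + 2) _ _) (.cons (g ≫ f) c)
        (fun j => .cons f (Chain.compAt j (.cons g c))) i

/-- Splitting off the last morphism: `(f⁰, …, fⁿ) ↦ (fⁿ, (f⁰, …, fⁿ⁻¹))`. -/
def Chain.unsnoc : {n : ℕ} → {X Y : C} → Chain C (n + 1) X Y → Σ Z : C, (X ⟶ Z) × Chain C n Z Y
  | 0, _, Y, .cons f (.nil _) => ⟨Y, f, .nil Y⟩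
  | _ + 1, _, _, .cons f c =>
      ⟨(Chain.unsnoc c).1, (Chain.unsnoc c).2.1, .cons f (Chain.unsnoc c).2.2⟩

variable (C) in
/-- The cyclic tuples `(f⁰, …, fⁿ)` with `f⁰ : X₁ ⟶ X₀`, `f¹ : X₂ ⟶ X₁`, …, `fⁿ : X₀ ⟶ Xₙ`. The
elementary tensors `f⁰ ⊗ ⋯ ⊗ fⁿ` of the cyclic nerve `CNₙ(C)` are indexed by them. -/
abbrev CyclicChain (n : ℕ) : Type (max u v) := Σ X : C, Chain C (n + 1) X X

/-- `(f⁰, …, fⁿ) ↦ (fⁿ, f⁰, …, fⁿ⁻¹)`. -/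
def CyclicChain.rotate {n : ℕ} (c : CyclicChain C n) : CyclicChain C n :=
  ⟨c.2.unsnoc.1, .cons c.2.unsnoc.2.1 c.2.unsnoc.2.2⟩

/-- `(f⁰, …, fⁿ⁺¹) ↦ (f⁰, …, fⁱ ∘ fⁱ⁺¹, …, fⁿ⁺¹)` for `0 ≤ i ≤ n`. -/
def CyclicChain.face {n : ℕ} (i : Fin (n + 1)) (c : CyclicChain C (n + 1)) : CyclicChain C n :=
  ⟨c.1, c.2.compAt i⟩

/-- `(f⁰, …, fⁿ⁺¹) ↦ (fⁿ⁺¹ ∘ f⁰, f¹, …, fⁿ)`. -/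
def CyclicChain.lastFace {n : ℕ} (c : CyclicChain C (n + 1)) : CyclicChain C n :=
  CyclicChain.face 0 c.rotate

/-- The Hochschild coboundary `b = ∑_{i=0}^{n+1} (-1)^i δᵢ`. -/
def hochschildB (n : ℕ) : (CyclicChain C n → ℂ) →ₗ[ℂ] (CyclicChain C (n + 1) → ℂ) where
  toFun φ c := (∑ i : Fin (n + 1), (-1) ^ (i : ℕ) * φ (c.face i)) + (-1) ^ (n + 1) * φ c.lastFace
  map_add' φ ψ := by
    funext c
    simp only [Pi.add_apply, mul_add, Finset.sum_add_distrib]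
    ring
  map_smul' a φ := by
    funext c
    simp only [Pi.smul_apply, smul_eq_mul, RingHom.id_apply, mul_add, Finset.mul_sum]
    congr 1
    · exact Finset.sum_congr rfl fun i _ => by ring
    · ring

/-- The signed cyclic operator `λ = (-1)^n τₙ`. -/
def cyclicLambda (n : ℕ) : (CyclicChain C n → ℂ) →ₗ[ℂ] (CyclicChain C n → ℂ) where
  toFun φ c := (-1) ^ n * φ c.rotate
  map_add' φ ψ := by
    funext c
    simp only [Pi.add_apply, mul_add]
  map_smul' a φ := by
    funext c
    simp only [Pi.smul_apply, smul_eq_mul, RingHom.id_apply]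
    ring

variable [Preadditive C] [Linear ℂ C]

/-- A function of `(f⁰, …, fⁿ⁻¹)` which is `ℂ`-linear in each `fⁱ` separately. -/
def IsMultilinear : {n : ℕ} → {X Y : C} → (Chain C n X Y → ℂ) → Prop
  | 0, _, _, _ => True
  | n + 1, X, Y, φ => ∀ Z : C,
      (∀ c : Chain C n X Z, IsLinearMap ℂ fun f : Z ⟶ Y => φ (.cons f c)) ∧
      ∀ f : Z ⟶ Y, IsMultilinear fun c : Chain C n X Z => φ (.cons f c)

theorem IsMultilinear.zero : ∀ {n : ℕ} {X Y : C}, IsMultilinear fun _ : Chain C n X Y => (0 : ℂ)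
  | 0, _, _ => trivial
  | _ + 1, _, _ => fun _ =>
      ⟨fun _ => ⟨fun _ _ => by simp, fun _ _ => by simp⟩, fun _ => IsMultilinear.zero⟩

theorem IsMultilinear.add : ∀ {n : ℕ} {X Y : C} {φ ψ : Chain C n X Y → ℂ},
    IsMultilinear φ → IsMultilinear ψ → IsMultilinear fun c => φ c + ψ c
  | 0, _, _, _, _, _, _ => trivial
  | _ + 1, _, _, _, _, h, h' => fun Z =>
      ⟨fun c =>
        ⟨fun f g => by dsimp only; rw [((h Z).1 c).map_add f g, ((h' Z).1 c).map_add f g]; ring,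
          fun a f => by
            dsimp only
            rw [((h Z).1 c).map_smul a f, ((h' Z).1 c).map_smul a f, smul_add]⟩,
        fun f => IsMultilinear.add ((h Z).2 f) ((h' Z).2 f)⟩

theorem IsMultilinear.smul (a : ℂ) : ∀ {n : ℕ} {X Y : C} {φ : Chain C n X Y → ℂ},
    IsMultilinear φ → IsMultilinear fun c => a * φ c
  | 0, _, _, _, _ => trivial
  | _ + 1, _, _, _, h => fun Z =>
      ⟨fun c =>
        ⟨fun f g => by dsimp only; rw [((h Z).1 c).map_add f g, mul_add],
          fun b f => by
            dsimp only
            rw [((h Z).1 c).map_smul b f, smul_eq_mul, smul_eq_mul]; ring⟩,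
        fun f => IsMultilinear.smul a ((h Z).2 f)⟩

variable (C)

/-- `CNⁿ(C) = Hom(CNₙ(C), ℂ)`. As `CNₙ(C)` is the direct sum, over all `(X₀, …, Xₙ)`, of the
tensor products `Hom(X₁, X₀) ⊗ ⋯ ⊗ Hom(X₀, Xₙ)`, a linear form on it is a function of the cyclic
tuples `(f⁰, …, fⁿ)` which is `ℂ`-linear in each `fⁱ`. -/
def cochains (n : ℕ) : Submodule ℂ (CyclicChain C n → ℂ) where
  carrier := {φ | ∀ X : C, IsMultilinear fun c : Chain C (n + 1) X X => φ ⟨X, c⟩}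
  zero_mem' _ := IsMultilinear.zero
  add_mem' h h' X := IsMultilinear.add (h X) (h' X)
  smul_mem' a _ h X := IsMultilinear.smul a (h X)

/-- `C_λⁿ(C) = Ker(1 - λ) ⊆ CNⁿ(C)`. -/
def cyclicCochains (n : ℕ) : Submodule ℂ (CyclicChain C n → ℂ) :=
  cochains C n ⊓ LinearMap.ker (LinearMap.id - cyclicLambda n)

/-- The cyclic cocycles `Z_λⁿ(C)`. -/
def cyclicCocycles (n : ℕ) : Submodule ℂ (CyclicChain C n → ℂ) :=
  cyclicCochains C n ⊓ LinearMap.ker (hochschildB n)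

/-- The cyclic coboundaries `B_λⁿ(C) = b(C_λⁿ⁻¹(C))`. -/
def cyclicCoboundaries : (n : ℕ) → Submodule ℂ (CyclicChain C n → ℂ)
  | 0 => ⊥
  | n + 1 => (cyclicCochains C n).map (hochschildB n)

/-- The cyclic cohomology `H_λⁿ(C) = Z_λⁿ(C) / B_λⁿ(C)`. -/
abbrev CyclicCohomology (n : ℕ) : Type (max u v) :=
  cyclicCocycles C n ⧸ (cyclicCoboundaries C n).submoduleOf (cyclicCocycles C n)

end CyclicNerve

/-! ### DG-semicategories, closed graded traces, cycles and their characters -/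

/-- A `ℂ`-linear differential graded semicategory (identities are not required). The component
`Hom n X Y` is the space of morphisms `X ⟶ Y` of degree `n`, and `comp g f` is `g ∘ f`. The degree
of a composite or a differential is a separate index with an equation, so that no transport
between, say, degrees `(i + j) + k` and `i + (j + k)` is needed. -/
structure DGSemicategory where
  Obj : Type u
  Hom : ℕ → Obj → Obj → Type v
  [addCommGroup : ∀ n X Y, AddCommGroup (Hom n X Y)]
  [module : ∀ n X Y, Module ℂ (Hom n X Y)]
  d : ∀ {i n : ℕ} (_ : i + 1 = n) {X Y : Obj}, Hom i X Y →ₗ[ℂ] Hom n X Y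
  comp : ∀ {i j n : ℕ} (_ : i + j = n) {X Y Z : Obj},
    Hom i Y Z →ₗ[ℂ] Hom j X Y →ₗ[ℂ] Hom n X Z
  assoc : ∀ {i j k a b n : ℕ} (h₁ : i + j = a) (h₂ : a + k = n) (h₃ : j + k = b) (h₄ : i + b = n)
    {W X Y Z : Obj} (f : Hom i Y Z) (g : Hom j X Y) (h : Hom k W X),
    comp h₂ (comp h₁ f g) h = comp h₄ f (comp h₃ g h)
  d_d : ∀ {i j k : ℕ} (h₁ : i + 1 = j) (h₂ : j + 1 = k) {X Y : Obj} (f : Hom i X Y),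
    d h₂ (d h₁ f) = 0
  leibniz : ∀ {i j n i' j' n' : ℕ} (h : i + j = n) (hi : i + 1 = i') (hj : j + 1 = j')
    (hn : n + 1 = n') (h₁ : i' + j = n') (h₂ : i + j' = n')
    {X Y Z : Obj} (g : Hom i Y Z) (f : Hom j X Y),
    d hn (comp h g f) = comp h₁ (d hi g) f + (-1 : ℂ) ^ i • comp h₂ g (d hj f)

attribute [instance] DGSemicategory.addCommGroup DGSemicategory.module

/-- A closed graded trace of dimension `n`. -/
structure ClosedGradedTrace (S : DGSemicategory.{v, u}) (n : ℕ) where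
  tr : ∀ X : S.Obj, S.Hom n X X →ₗ[ℂ] ℂ
  closed : ∀ {i : ℕ} (h : i + 1 = n) {X : S.Obj} (f : S.Hom i X X), tr X (S.d h f) = 0
  graded : ∀ {i j : ℕ} (h : i + j = n) (h' : j + i = n) {X Y : S.Obj}
    (g : S.Hom i Y X) (g' : S.Hom j X Y),
    tr X (S.comp h g g') = (-1) ^ (i * j) * tr Y (S.comp h' g' g)

section Cycles

variable (C : Type u) [Category.{v} C] [Preadditive C] [Linear ℂ C]

universe v' u'

/-- A `ℂ`-linear semifunctor from `C` to the degree zero part `S⁰` of a DG-semicategory `S`. -/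
structure LinearSemifunctor (S : DGSemicategory.{v', u'}) where
  obj : C → S.Obj
  map : ∀ {X Y : C}, (X ⟶ Y) →ₗ[ℂ] S.Hom 0 (obj X) (obj Y)
  map_comp : ∀ {X Y Z : C} (f : X ⟶ Y) (g : Y ⟶ Z),
    map (f ≫ g) = S.comp (Nat.add_zero 0) (map g) (map f)

/-- An `n`-dimensional cycle over `C`. -/
structure Cycle (n : ℕ) where
  S : DGSemicategory.{v', u'}
  T : ClosedGradedTrace S n
  ρ : LinearSemifunctor C S

variable {C}

/-- `(f⁰, …, fⁿ) ↦ ∂ρ(f⁰) ∂ρ(f¹) ⋯ ∂ρ(fⁿ)`. -/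
def LinearSemifunctor.dWord {S : DGSemicategory.{v', u'}} (ρ : LinearSemifunctor C S) :
    {n : ℕ} → {X Y : C} → Chain C (n + 1) X Y → S.Hom (n + 1) (ρ.obj X) (ρ.obj Y)
  | 0, _, _, .cons f (.nil _) => S.d (Nat.zero_add 1) (ρ.map f)
  | n + 1, _, _, .cons f c =>
      S.comp (Nat.add_comm 1 (n + 1)) (S.d (Nat.zero_add 1) (ρ.map f)) (ρ.dWord c)

/-- `(f⁰, …, fⁿ) ↦ ρ(f⁰) ∂ρ(f¹) ⋯ ∂ρ(fⁿ)`. -/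
def LinearSemifunctor.word {S : DGSemicategory.{v', u'}} (ρ : LinearSemifunctor C S) :
    {n : ℕ} → {X Y : C} → Chain C (n + 1) X Y → S.Hom n (ρ.obj X) (ρ.obj Y)
  | 0, _, _, .cons f (.nil _) => ρ.map f
  | n + 1, _, _, .cons f c => S.comp (Nat.zero_add (n + 1)) (ρ.map f) (ρ.dWord c)

/-- The character `f⁰ ⊗ ⋯ ⊗ fⁿ ↦ T(ρ(f⁰) ∂ρ(f¹) ⋯ ∂ρ(fⁿ))` of a cycle. -/
def Cycle.character {n : ℕ} (A : Cycle.{v, u, v', u'} C n) : CyclicChain C n → ℂ :=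
  fun c => A.T.tr (A.ρ.obj c.1) (A.ρ.word c.2)

end Cycles

/-! ### Even Fredholm modules -/

section Fredholm

variable (C : Type u) [Category.{v} C] [Preadditive C] [Linear ℂ C]

/-- A pair `(ℋ, ℱ)`: a `ℂ`-linear functor `ℋ` from `C` to `ℤ/2`-graded separable Hilbert spaces
with all `ℋ(f)` of degree `0`, and bounded operators `ℱ_X` of degree `1` on `ℋ(X)` with square
the identity. An operator has degree `0` (degree `1`) if it commutes (anticommutes) with the
grading operators. -/
structure FredholmPair where
  functor : C ⥤ GradedHilb.{w}
  [additive : functor.Additive]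
  [linear : functor.Linear ℂ]
  F : ∀ X : C, (functor.obj X).carrier →L[ℂ] (functor.obj X).carrier
  map_even : ∀ {X Y : C} (f : X ⟶ Y),
    (functor.obj Y).ε ∘L GradedHilb.toOp (functor.map f) =
      GradedHilb.toOp (functor.map f) ∘L (functor.obj X).ε
  F_odd : ∀ X : C, (functor.obj X).ε ∘L F X = -(F X ∘L (functor.obj X).ε)
  F_sq : ∀ X : C, F X ∘L F X = ContinuousLinearMap.id ℂ (functor.obj X).carrier

attribute [instance] FredholmPair.additive FredholmPair.linear

variable {C}

namespace FredholmPair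

variable (P : FredholmPair.{w} C)

/-- The Hilbert space `ℋ(X)`. -/
abbrev H (X : C) : Type w := (P.functor.obj X).carrier

/-- The operator `ℋ(f)`. -/
def op {X Y : C} (f : X ⟶ Y) : P.H X →L[ℂ] P.H Y := GradedHilb.toOp (P.functor.map f)

theorem op_id (X : C) : P.op (𝟙 X) = ContinuousLinearMap.id ℂ (P.H X) :=
  P.functor.map_id X

theorem op_comp {X Y Z : C} (f : X ⟶ Y) (g : Y ⟶ Z) : P.op (f ≫ g) = P.op g ∘L P.op f :=
  P.functor.map_comp f g

theorem op_add {X Y : C} (f g : X ⟶ Y) : P.op (f + g) = P.op f + P.op g :=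
  P.functor.map_add

theorem op_smul {X Y : C} (a : ℂ) (f : X ⟶ Y) : P.op (a • f) = a • P.op f :=
  Functor.Linear.map_smul f a

/-- `[ℱ, T] = ℱ_Y T - (-1)^j T ℱ_X`, the graded commutator with an operator `T` of degree `j`. -/
def gradedComm (j : ℕ) {X Y : C} : (P.H X →L[ℂ] P.H Y) →ₗ[ℂ] (P.H X →L[ℂ] P.H Y) where
  toFun T := P.F Y ∘L T - (-1 : ℂ) ^ j • (T ∘L P.F X)
  map_add' S T := by
    simp only [ContinuousLinearMap.comp_add, ContinuousLinearMap.add_comp, smul_add]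
    abel
  map_smul' a T := by
    simp only [ContinuousLinearMap.comp_smul, ContinuousLinearMap.smul_comp, RingHom.id_apply,
      smul_sub, smul_comm a]

/-- `[ℱ, f] = ℱ_Y ℋ(f) - ℋ(f) ℱ_X`. -/
def comm {X Y : C} (f : X ⟶ Y) : P.H X →L[ℂ] P.H Y :=
  P.F Y ∘L P.op f - P.op f ∘L P.F X

/-- The pair is a `p`-summable even Fredholm module. -/
def IsSummable (p : ℝ) : Prop :=
  ∀ {X Y : C} (f : X ⟶ Y), IsSchatten p (P.comm f)

/-- `(f¹, …, fʲ) ↦ [ℱ, f¹] ⋯ [ℱ, fʲ]`. -/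
def commProd : {j : ℕ} → {X Y : C} → Chain C j X Y → (P.H X →L[ℂ] P.H Y)
  | _, _, _, .nil X => ContinuousLinearMap.id ℂ (P.H X)
  | _, _, _, .cons f c => P.comm f ∘L commProd c

/-- The operators `ℋ(f̃⁰)[ℱ, f¹] ⋯ [ℱ, fʲ] : ℋ(X) ⟶ ℋ(Y)`. Here `f̃⁰ = f⁰ + μ`, where `μ` is a
scalar which must vanish if `j = 0` or if source and target of `f⁰` are different objects. -/
def omegaGenerators : (j : ℕ) → (X Y : C) → Set (P.H X →L[ℂ] P.H Y)
  | 0, X, Y => {T | ∃ f : X ⟶ Y, T = P.op f}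
  | j + 1, X, Y =>
      {T | ∃ (X₁ : C) (f₀ : X₁ ⟶ Y) (c : Chain C (j + 1) X X₁), T = P.op f₀ ∘L P.commProd c} ∪
      {T | ∃ (f₀ : Y ⟶ Y) (μ : ℂ) (c : Chain C (j + 1) X Y),
        T = (P.op f₀ + μ • ContinuousLinearMap.id ℂ (P.H Y)) ∘L P.commProd c}

/-- The degree `j` morphisms of `Ω_{(ℋ, ℱ)} C`, a linear subspace of the bounded operators. -/
def omegaHom (j : ℕ) (X Y : C) : Submodule ℂ (P.H X →L[ℂ] P.H Y) :=
  Submodule.span ℂ (P.omegaGenerators j X Y)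

theorem F_comm {X Y : C} (f : X ⟶ Y) : P.F Y ∘L P.comm f = -(P.comm f ∘L P.F X) := by
  have h1 := fun T : P.H X →L[ℂ] P.H Y => congrArg (fun S => S ∘L T) (P.F_sq Y)
  have h2 := fun T : P.H X →L[ℂ] P.H Y => congrArg (fun S => T ∘L S) (P.F_sq X)
  simp only [ContinuousLinearMap.comp_assoc, ContinuousLinearMap.id_comp,
    ContinuousLinearMap.comp_id] at h1 h2
  simp only [comm, ContinuousLinearMap.comp_sub, ContinuousLinearMap.sub_comp,
    ContinuousLinearMap.comp_assoc, h1, h2]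
  abel

theorem F_commProd : ∀ {j : ℕ} {X Y : C} (c : Chain C j X Y),
    P.F Y ∘L P.commProd c = (-1 : ℂ) ^ j • (P.commProd c ∘L P.F X)
  | _, _, _, .nil X => by
      simp [commProd, ContinuousLinearMap.id_comp, ContinuousLinearMap.comp_id]
  | _, _, _, .cons f c => by
      rw [commProd, ← ContinuousLinearMap.comp_assoc, F_comm, ContinuousLinearMap.neg_comp,
        ContinuousLinearMap.comp_assoc, F_commProd c, ContinuousLinearMap.comp_smul,
        ContinuousLinearMap.comp_assoc, pow_succ, mul_neg_one, neg_smul]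

theorem omegaHom_eq (j : ℕ) (X Y : C) : P.omegaHom j X Y =
    Submodule.span ℂ {T | ∃ (X₁ : C) (f₀ : X₁ ⟶ Y) (c : Chain C j X X₁),
      T = P.op f₀ ∘L P.commProd c} := by
  cases j with
  | zero =>
    refine congrArg (Submodule.span ℂ) (Set.ext fun T => ?_)
    constructor
    · rintro ⟨f, rfl⟩
      exact ⟨X, f, .nil X, by rw [commProd, ContinuousLinearMap.comp_id]⟩
    · rintro ⟨X₁, f₀, c, rfl⟩
      cases c
      exact ⟨f₀, by rw [commProd, ContinuousLinearMap.comp_id]⟩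
  | succ j =>
    refine le_antisymm (Submodule.span_le.2 ?_) (Submodule.span_mono Set.subset_union_left)
    rintro T (hT | ⟨f₀, μ, c, rfl⟩)
    · exact Submodule.subset_span hT
    · refine Submodule.subset_span ⟨Y, f₀ + μ • 𝟙 Y, c, ?_⟩
      rw [op_add, op_smul, op_id]

theorem op_comp_commProd_mem {j : ℕ} {X Y Z : C} (f : Y ⟶ Z) (c : Chain C j X Y) :
    P.op f ∘L P.commProd c ∈ P.omegaHom j X Z := by
  rw [omegaHom_eq]
  exact Submodule.subset_span ⟨Y, f, c, rfl⟩

theorem commProd_mem {j : ℕ} {X Y : C} (c : Chain C j X Y) :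
    P.commProd c ∈ P.omegaHom j X Y := by
  have := P.op_comp_commProd_mem (𝟙 Y) c
  rwa [op_id, ContinuousLinearMap.id_comp] at this

theorem omegaHom_induction {j : ℕ} {X Y : C} {p : (P.H X →L[ℂ] P.H Y) → Prop}
    (mem : ∀ {X₁ : C} (f : X₁ ⟶ Y) (c : Chain C j X X₁), p (P.op f ∘L P.commProd c))
    (zero : p 0) (add : ∀ S T, p S → p T → p (S + T)) (smul : ∀ (a : ℂ) T, p T → p (a • T))
    {T : P.H X →L[ℂ] P.H Y} (hT : T ∈ P.omegaHom j X Y) : p T := by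
  rw [omegaHom_eq] at hT
  induction hT using Submodule.span_induction with
  | mem T h => obtain ⟨X₁, f, c, rfl⟩ := h; exact mem f c
  | zero => exact zero
  | add S T _ _ hS hT => exact add S T hS hT
  | smul a T _ hT => exact smul a T hT

theorem op_comp_mem {j : ℕ} {X Y Z : C} (f : Y ⟶ Z) {T : P.H X →L[ℂ] P.H Y}
    (hT : T ∈ P.omegaHom j X Y) : P.op f ∘L T ∈ P.omegaHom j X Z := by
  refine P.omegaHom_induction (p := fun T => P.op f ∘L T ∈ P.omegaHom j X Z) ?_ ?_ ?_ ?_ hT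
  · intro X₁ g c
    rw [← ContinuousLinearMap.comp_assoc, ← op_comp]
    exact P.op_comp_commProd_mem _ c
  · rw [ContinuousLinearMap.comp_zero]; exact Submodule.zero_mem _
  · intro S T hS hT
    rw [ContinuousLinearMap.comp_add]; exact Submodule.add_mem _ hS hT
  · intro a T hT
    rw [ContinuousLinearMap.comp_smul]; exact Submodule.smul_mem _ a hT

theorem comm_comp_mem {j : ℕ} {X Y Z : C} (f : Y ⟶ Z) {T : P.H X →L[ℂ] P.H Y}
    (hT : T ∈ P.omegaHom j X Y) : P.comm f ∘L T ∈ P.omegaHom (j + 1) X Z := by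
  refine P.omegaHom_induction (p := fun T => P.comm f ∘L T ∈ P.omegaHom (j + 1) X Z)
    ?_ ?_ ?_ ?_ hT
  · intro X₁ g c
    have h : P.comm f ∘L P.op g = P.comm (g ≫ f) - P.op f ∘L P.comm g := by
      simp only [comm, op_comp, ContinuousLinearMap.comp_sub, ContinuousLinearMap.sub_comp,
        ContinuousLinearMap.comp_assoc]
      abel
    rw [← ContinuousLinearMap.comp_assoc, h, ContinuousLinearMap.sub_comp,
      ContinuousLinearMap.comp_assoc]
    exact Submodule.sub_mem _ (P.commProd_mem (.cons (g ≫ f) c))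
      (P.op_comp_commProd_mem f (.cons g c))
  · rw [ContinuousLinearMap.comp_zero]; exact Submodule.zero_mem _
  · intro S T hS hT
    rw [ContinuousLinearMap.comp_add]; exact Submodule.add_mem _ hS hT
  · intro a T hT
    rw [ContinuousLinearMap.comp_smul]; exact Submodule.smul_mem _ a hT

theorem commProd_comp_mem {j : ℕ} {X : C} : ∀ {i n : ℕ} (_ : i + j = n) {Y Z : C}
    (c : Chain C i Y Z) {T : P.H X →L[ℂ] P.H Y} (_ : T ∈ P.omegaHom j X Y),
    P.commProd c ∘L T ∈ P.omegaHom n X Z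
  | 0, n, h, _, _, .nil Y, T, hT => by
      obtain rfl : j = n := by omega
      rwa [commProd, ContinuousLinearMap.id_comp]
  | i + 1, n, h, _, _, .cons f c, T, hT => by
      obtain ⟨n, rfl⟩ : ∃ k, n = k + 1 := ⟨i + j, by omega⟩
      rw [commProd, ContinuousLinearMap.comp_assoc]
      exact P.comm_comp_mem f (commProd_comp_mem (by omega) c hT)

theorem omegaHom_comp_mem {i j n : ℕ} (h : i + j = n) {X Y Z : C} {S : P.H Y →L[ℂ] P.H Z}
    {T : P.H X →L[ℂ] P.H Y} (hS : S ∈ P.omegaHom i Y Z) (hT : T ∈ P.omegaHom j X Y) :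
    S ∘L T ∈ P.omegaHom n X Z := by
  refine P.omegaHom_induction (p := fun S => S ∘L T ∈ P.omegaHom n X Z) ?_ ?_ ?_ ?_ hS
  · intro X₁ f c
    rw [ContinuousLinearMap.comp_assoc]
    exact P.op_comp_mem f (P.commProd_comp_mem h c hT)
  · rw [ContinuousLinearMap.zero_comp]; exact Submodule.zero_mem _
  · intro S S' hS hS'
    rw [ContinuousLinearMap.add_comp]; exact Submodule.add_mem _ hS hS'
  · intro a S hS
    rw [ContinuousLinearMap.smul_comp]; exact Submodule.smul_mem _ a hS

theorem gradedComm_mem {i n : ℕ} (h : i + 1 = n) {X Y : C} {T : P.H X →L[ℂ] P.H Y}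
    (hT : T ∈ P.omegaHom i X Y) : P.gradedComm i T ∈ P.omegaHom n X Y := by
  subst h
  refine P.omegaHom_induction (p := fun T => P.gradedComm i T ∈ P.omegaHom (i + 1) X Y)
    ?_ ?_ ?_ ?_ hT
  · intro X₁ f c
    have h : P.gradedComm i (P.op f ∘L P.commProd c) = P.commProd (.cons f c) := by
      change P.F Y ∘L (P.op f ∘L P.commProd c)
        - (-1 : ℂ) ^ i • ((P.op f ∘L P.commProd c) ∘L P.F X) = _
      rw [commProd, comm, ContinuousLinearMap.comp_assoc (P.op f), ← ContinuousLinearMap.comp_smul,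
        ← F_commProd, ContinuousLinearMap.sub_comp, ContinuousLinearMap.comp_assoc,
        ContinuousLinearMap.comp_assoc]
    rw [h]
    exact P.commProd_mem _
  · rw [map_zero]; exact Submodule.zero_mem _
  · intro S T hS hT
    rw [map_add]; exact Submodule.add_mem _ hS hT
  · intro a T hT
    rw [map_smul]; exact Submodule.smul_mem _ a hT

theorem gradedComm_gradedComm (i : ℕ) {X Y : C} (T : P.H X →L[ℂ] P.H Y) :
    P.gradedComm (i + 1) (P.gradedComm i T) = 0 := by
  have h1 := congrArg (fun S => S ∘L T) (P.F_sq Y)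
  have h2 := congrArg (fun S => T ∘L S) (P.F_sq X)
  simp only [ContinuousLinearMap.comp_assoc, ContinuousLinearMap.id_comp,
    ContinuousLinearMap.comp_id] at h1 h2
  have h3 : (-1 : ℂ) ^ i * (-1) ^ i = 1 := by rw [← mul_pow]; simp
  simp only [gradedComm, LinearMap.coe_mk, AddHom.coe_mk, ContinuousLinearMap.comp_sub,
    ContinuousLinearMap.sub_comp, ContinuousLinearMap.comp_smul, ContinuousLinearMap.smul_comp,
    ContinuousLinearMap.comp_assoc, h1, h2, pow_succ, smul_sub, smul_smul, mul_neg_one, neg_smul,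
    h3, one_smul]
  abel

theorem gradedComm_comp (i j : ℕ) {X Y Z : C} (S : P.H Y →L[ℂ] P.H Z) (T : P.H X →L[ℂ] P.H Y) :
    P.gradedComm (i + j) (S ∘L T) =
      P.gradedComm i S ∘L T + (-1 : ℂ) ^ i • (S ∘L P.gradedComm j T) := by
  simp only [gradedComm, LinearMap.coe_mk, AddHom.coe_mk, ContinuousLinearMap.comp_sub,
    ContinuousLinearMap.sub_comp, ContinuousLinearMap.comp_smul, ContinuousLinearMap.smul_comp,
    ContinuousLinearMap.comp_assoc, pow_add, smul_sub, smul_smul]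
  abel

/-- The DG-semicategory `(Ω_{(ℋ, ℱ)} C, ∂')`: composition is composition of operators and
`∂' = [ℱ, -]`. -/
def Omega : DGSemicategory.{w, u} where
  Obj := C
  Hom j X Y := P.omegaHom j X Y
  d {i _} h {_ _} := (P.gradedComm i).restrict fun _ hT => P.gradedComm_mem h hT
  comp {_ _ _} h {_ _ _} := LinearMap.mk₂ ℂ
    (fun S T => ⟨S.1 ∘L T.1, P.omegaHom_comp_mem h S.2 T.2⟩)
    (fun _ _ _ => Subtype.ext (ContinuousLinearMap.add_comp _ _ _))
    (fun _ _ _ => Subtype.ext (ContinuousLinearMap.smul_comp _ _ _))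
    (fun _ _ _ => Subtype.ext (ContinuousLinearMap.comp_add _ _ _))
    (fun _ _ _ => Subtype.ext (ContinuousLinearMap.comp_smul _ _ _))
  assoc {_ _ _ _ _ _} _ _ _ _ {_ _ _ _} _ _ _ := Subtype.ext (ContinuousLinearMap.comp_assoc _ _ _)
  d_d {_ _ _} h₁ _ {_ _} f := by
    subst h₁
    exact Subtype.ext (P.gradedComm_gradedComm _ f.1)
  leibniz {_ _ _ _ _ _} h _ _ _ _ _ {_ _ _} g f := by
    subst h
    exact Subtype.ext (P.gradedComm_comp _ _ g.1 f.1)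

/-- The semifunctor `ρ' : C ⟶ Ω⁰_{(ℋ, ℱ)} C`, the identity on objects and `f ↦ ℋ(f)`. -/
def rho : LinearSemifunctor C P.Omega where
  obj X := X
  map {_ _} :=
    (⟨⟨fun f => ⟨P.op f, Submodule.subset_span ⟨f, rfl⟩⟩,
      fun f g => Subtype.ext (P.op_add f g)⟩, fun a f => Subtype.ext (P.op_smul a f)⟩ :
      (_ ⟶ _) →ₗ[ℂ] P.omegaHom 0 _ _)
  map_comp f g := Subtype.ext (P.op_comp f g)

/-- `Tr_s(T) = ½ Tr(ε ℱ_X [ℱ, T])` for an operator `T` of degree `j` on `ℋ(X)` such that `[ℱ, T]`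
is of trace class. -/
def superTrace (j : ℕ) {X : C} (T : P.H X →L[ℂ] P.H X) : ℂ :=
  1 / 2 * trace ((P.functor.obj X).ε ∘L P.F X ∘L P.gradedComm j T)

/-- `φ²ᵐ(f⁰ ⊗ ⋯ ⊗ f²ᵐ) = Tr_s(ℋ(f⁰)[ℱ, f¹] ⋯ [ℱ, f²ᵐ])`. -/
def phi (m : ℕ) : CyclicChain C (2 * m) → ℂ
  | ⟨_, .cons f₀ c⟩ => P.superTrace (2 * m) (P.op f₀ ∘L P.commProd c)

open Classical in
/-- The Chern character `ch²ᵐ(ℋ, ℱ)`: the class in `H_λ²ᵐ(C)` of the cyclic cocycle `φ²ᵐ`. (It is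
meaningful only if `φ²ᵐ` is a cyclic cocycle; the value is `0` otherwise.) -/
def chern (m : ℕ) : CyclicCohomology C (2 * m) :=
  if h : P.phi m ∈ cyclicCocycles C (2 * m) then Submodule.Quotient.mk ⟨P.phi m, h⟩ else 0

end FredholmPair

end Fredholm

end FredholmCat

end

/-! Put `N = 2m + 1`, so that `p ≤ N`. A compact operator lies within its `n`-th singular value of
an operator of rank at most `n` (`rankApprox_singularValue`), and no operator of rank at most `n` is
closer (`le_of_mem_singularSet`). Ranks add and errors multiply under composition, so a product of
`j` commutators `[ℱ, f]` has approximation numbers bounded by the `j`-th power of an `ℓ^N` sequence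
(`powApprox_omegaHom`). Hence operators of degree `N` in `Ω'` are of trace class.

Finite-rank approximation yields `Tr(AB) = Tr(BA)` for complementary exponents (`trace_comp_comm`).
As `ε` and `ℱ` anticommute and `N` is odd, `τ(T) = ½ Tr(ε ℱ T)` on degree `N` is then invariant
under cyclic exchange of two factors, provided that one of positive degree graded-commutes with `ℱ`
(`oddTrace_comp_comm`).

Now `Tr_s = τ ∘ ∂'`. Closedness is `∂'² = 0`; the graded trace property is the Leibniz rule followed
by cyclicity of `τ`. Moreover `φ(f⁰, …, f²ᵐ) = τ([ℱ, f⁰] ⋯ [ℱ, f²ᵐ])` (`phi_eq_oddTrace`), which is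
visibly cyclic. Since `[ℱ, -]` is a derivation, the inner faces of `bφ` telescope to two end terms,
and cyclicity of `τ` cancels these against the last face. -/

noncomputable section

namespace FredholmCat

/-! ### Singular values as distances to operators of finite rank -/

section SingularValues

variable {E G K : Type w} [NormedAddCommGroup E] [InnerProductSpace ℂ E]
  [NormedAddCommGroup G] [InnerProductSpace ℂ G] [NormedAddCommGroup K] [InnerProductSpace ℂ K]

/-- `T` is within distance `r` of an operator of rank at most `n`. -/
def RankApprox (T : E →L[ℂ] G) (n : ℕ) (r : ℝ) : Prop :=
  ∃ R : E →L[ℂ] G, (R : E →ₗ[ℂ] G).rank ≤ n ∧ ‖T - R‖ ≤ r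

theorem RankApprox.mono {T : E →L[ℂ] G} {n n' : ℕ} {r r' : ℝ} (h : RankApprox T n r)
    (hn : n ≤ n') (hr : r ≤ r') : RankApprox T n' r' := by
  obtain ⟨R, hR, hTR⟩ := h
  exact ⟨R, hR.trans (by exact_mod_cast hn), hTR.trans hr⟩

theorem RankApprox.nonneg {T : E →L[ℂ] G} {n : ℕ} {r : ℝ} (h : RankApprox T n r) : 0 ≤ r := by
  obtain ⟨R, _, hTR⟩ := h
  exact (norm_nonneg _).trans hTR

theorem rankApprox_norm (T : E →L[ℂ] G) (n : ℕ) : RankApprox T n ‖T‖ :=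
  ⟨0, by simp, by simp⟩

theorem rank_add_le {R S : E →L[ℂ] G} {n n' : ℕ} (hR : (R : E →ₗ[ℂ] G).rank ≤ n)
    (hS : (S : E →ₗ[ℂ] G).rank ≤ n') : ((R + S : E →L[ℂ] G) : E →ₗ[ℂ] G).rank ≤ (n + n' : ℕ) := by
  refine (LinearMap.rank_add_le (R : E →ₗ[ℂ] G) (S : E →ₗ[ℂ] G)).trans ?_
  push_cast
  exact add_le_add hR hS

theorem rank_smul_le (a : ℂ) {R : E →L[ℂ] G} {n : ℕ} (hR : (R : E →ₗ[ℂ] G).rank ≤ n) :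
    ((a • R : E →L[ℂ] G) : E →ₗ[ℂ] G).rank ≤ n := by
  have h : ((a • R : E →L[ℂ] G) : E →ₗ[ℂ] G) =
      (a • LinearMap.id : G →ₗ[ℂ] G) ∘ₗ (R : E →ₗ[ℂ] G) := by
    ext x
    simp
  rw [h]
  exact (LinearMap.rank_comp_le_right _ _).trans hR

theorem rank_neg_le {R : E →L[ℂ] G} {n : ℕ} (hR : (R : E →ₗ[ℂ] G).rank ≤ n) :
    ((-R : E →L[ℂ] G) : E →ₗ[ℂ] G).rank ≤ n := by
  rw [← neg_one_smul ℂ R]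
  exact rank_smul_le _ hR

theorem rank_comp_le_of_left {R : G →L[ℂ] K} (S : E →L[ℂ] G) {n : ℕ}
    (hR : (R : G →ₗ[ℂ] K).rank ≤ n) : ((R ∘L S : E →L[ℂ] K) : E →ₗ[ℂ] K).rank ≤ n :=
  (LinearMap.rank_comp_le_left (S : E →ₗ[ℂ] G) (R : G →ₗ[ℂ] K)).trans hR

theorem rank_comp_le_of_right (R : G →L[ℂ] K) {S : E →L[ℂ] G} {n : ℕ}
    (hS : (S : E →ₗ[ℂ] G).rank ≤ n) : ((R ∘L S : E →L[ℂ] K) : E →ₗ[ℂ] K).rank ≤ n :=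
  (LinearMap.rank_comp_le_right (S : E →ₗ[ℂ] G) (R : G →ₗ[ℂ] K)).trans hS

theorem RankApprox.add {S T : E →L[ℂ] G} {n n' : ℕ} {r r' : ℝ} (hS : RankApprox S n r)
    (hT : RankApprox T n' r') : RankApprox (S + T) (n + n') (r + r') := by
  obtain ⟨R, hR, hSR⟩ := hS
  obtain ⟨Q, hQ, hTQ⟩ := hT
  refine ⟨R + Q, rank_add_le hR hQ, ?_⟩
  rw [add_sub_add_comm]
  exact (norm_add_le _ _).trans (add_le_add hSR hTQ)

theorem RankApprox.smul (a : ℂ) {T : E →L[ℂ] G} {n : ℕ} {r : ℝ} (hT : RankApprox T n r) :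
    RankApprox (a • T) n (‖a‖ * r) := by
  obtain ⟨R, hR, hTR⟩ := hT
  refine ⟨a • R, rank_smul_le a hR, ?_⟩
  rw [← smul_sub, norm_smul]
  gcongr

/-- The approximant `RT + (S - R)Q` leaves exactly the error `(S - R)(T - Q)`. The product of the
two radii is what makes Schatten exponents combine as in Hölder's inequality. -/
theorem RankApprox.comp {S : G →L[ℂ] K} {T : E →L[ℂ] G} {n n' : ℕ} {r r' : ℝ}
    (hS : RankApprox S n r) (hT : RankApprox T n' r') :
    RankApprox (S ∘L T) (n + n') (r * r') := by
  have hr := hS.nonneg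
  obtain ⟨R, hR, hSR⟩ := hS
  obtain ⟨Q, hQ, hTQ⟩ := hT
  refine ⟨R ∘L T + (S - R) ∘L Q, rank_add_le (rank_comp_le_of_left T hR)
    (rank_comp_le_of_right _ hQ), ?_⟩
  have h : S ∘L T - (R ∘L T + (S - R) ∘L Q) = (S - R) ∘L (T - Q) := by
    simp only [ContinuousLinearMap.comp_sub, ContinuousLinearMap.sub_comp]
    abel
  rw [h]
  refine (ContinuousLinearMap.opNorm_comp_le _ _).trans ?_
  gcongr

theorem _root_.Orthonormal.norm_sum_smul_sq {ι : Type*} [Fintype ι] {e : ι → E}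
    (he : Orthonormal ℂ e) (a : ι → ℂ) : ‖∑ i, a i • e i‖ ^ 2 = ∑ i, ‖a i‖ ^ 2 := by
  have h := he.inner_sum a a Finset.univ
  rw [inner_self_eq_norm_sq_to_K] at h
  simp only [RCLike.conj_mul] at h
  exact_mod_cast h

variable [CompleteSpace E] [CompleteSpace G]

theorem absOp_comp_absOp (T : E →L[ℂ] G) :
    absOp T ∘L absOp T = ContinuousLinearMap.adjoint T ∘L T :=
  CFC.sqrt_mul_sqrt_self _
    ((ContinuousLinearMap.nonneg_iff_isPositive _).2 T.isPositive_adjoint_comp_self)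

theorem absOp_isPositive (T : E →L[ℂ] G) : (absOp T).IsPositive :=
  (ContinuousLinearMap.nonneg_iff_isPositive _).1 (CFC.sqrt_nonneg _)

theorem norm_absOp_apply (T : E →L[ℂ] G) (x : E) : ‖absOp T x‖ = ‖T x‖ := by
  have h1 : inner ℂ (absOp T x) (absOp T x) = inner ℂ (T x) (T x) := by
    have h : inner ℂ (absOp T x) (absOp T x) = inner ℂ (absOp T (absOp T x)) x :=
      ((absOp_isPositive T).isSymmetric (absOp T x) x).symm
    have h2 : absOp T (absOp T x) = ContinuousLinearMap.adjoint T (T x) :=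
      DFunLike.congr_fun (absOp_comp_absOp T) x
    rw [h, h2, ContinuousLinearMap.adjoint_inner_left]
  rw [inner_self_eq_norm_sq_to_K, inner_self_eq_norm_sq_to_K] at h1
  have h2 : ‖absOp T x‖ ^ 2 = ‖T x‖ ^ 2 := by exact_mod_cast h1
  exact (sq_eq_sq₀ (norm_nonneg _) (norm_nonneg _)).1 h2

/-- The set of lower bounds `t` whose supremum is the `n`-th singular value. -/
def singularSet (T : E →L[ℂ] G) (n : ℕ) : Set ℝ :=
  {t : ℝ | ∃ e : Fin (n + 1) → E, Orthonormal ℂ e ∧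
    ∀ i, ∃ s : ℝ, t ≤ s ∧ absOp T (e i) = (s : ℂ) • e i}

theorem eigenvalue_absOp_nonneg (T : E →L[ℂ] G) {x : E} (hx : ‖x‖ = 1) {s : ℝ}
    (h : absOp T x = (s : ℂ) • x) : 0 ≤ s := by
  have h1 := (absOp_isPositive T).re_inner_nonneg_right x
  rw [h, inner_smul_right, inner_self_eq_norm_sq_to_K, hx] at h1
  simpa using h1

/-- Min-max argument: on the span of `n + 1` orthonormal eigenvectors an operator `R` of rank at
most `n` kills some `x ≠ 0`, and there `t ‖x‖ ≤ ‖|T| x‖ = ‖(T - R) x‖ ≤ r ‖x‖`. -/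
theorem le_of_mem_singularSet {T : E →L[ℂ] G} {n : ℕ} {r t : ℝ} (h : RankApprox T n r)
    (ht : t ∈ singularSet T n) : t ≤ r := by
  have hr := h.nonneg
  obtain ⟨R, hR, hTR⟩ := h
  obtain ⟨e, he, hs⟩ := ht
  choose s hts hs using hs
  rcases le_or_gt t 0 with ht0 | ht0
  · exact ht0.trans hr
  let L : (Fin (n + 1) → ℂ) →ₗ[ℂ] G := (R : E →ₗ[ℂ] G) ∘ₗ Fintype.linearCombination ℂ e
  have hL : L.rank ≤ n := (LinearMap.rank_comp_le_left _ _).trans hR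
  obtain ⟨a, ha, ha0⟩ : ∃ a, L a = 0 ∧ a ≠ 0 := by
    by_contra! hcon
    have hinj : Function.Injective L := (injective_iff_map_eq_zero L).2 hcon
    have h1 : Module.finrank ℂ (LinearMap.range L) = n + 1 := by
      rw [LinearMap.finrank_range_of_inj hinj]; simp
    have h2 : Module.finrank ℂ (LinearMap.range L) ≤ n := Module.finrank_le_of_rank_le hL
    omega
  set x := Fintype.linearCombination ℂ e a with hx
  have hxs : x = ∑ i, a i • e i := Fintype.linearCombination_apply ℂ e a
  have hRx : R x = 0 := ha
  have hnx : ‖x‖ ^ 2 = ∑ i, ‖a i‖ ^ 2 := by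
    rw [hxs, he.norm_sum_smul_sq]
  have hnT : ‖T x‖ ^ 2 = ∑ i, (‖a i‖ * s i) ^ 2 := by
    have h : absOp T x = ∑ i, (a i * s i) • e i := by
      simp only [hxs, map_sum, map_smul, hs, smul_smul]
    rw [← norm_absOp_apply, h, he.norm_sum_smul_sq]
    simp [mul_pow]
  have hpos : 0 < ‖x‖ := by
    obtain ⟨i, hi⟩ := Function.ne_iff.1 ha0
    have h : 0 < ∑ i, ‖a i‖ ^ 2 :=
      Finset.sum_pos' (fun _ _ => by positivity)
        ⟨i, Finset.mem_univ i, pow_pos (norm_pos_iff.2 hi) 2⟩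
    rw [← hnx] at h
    exact norm_pos_iff.2 fun h0 => by simp [h0] at h
  have h1 : t * ‖x‖ ≤ ‖T x‖ := by
    refine le_of_sq_le_sq ?_ (norm_nonneg _)
    rw [mul_pow, hnx, hnT, Finset.mul_sum]
    refine Finset.sum_le_sum fun i _ => ?_
    rw [mul_pow, mul_comm]
    have := hts i
    gcongr
  have h2 : ‖T x‖ ≤ r * ‖x‖ := by
    have : T x = (T - R) x := by simp [hRx]
    rw [this]
    exact (ContinuousLinearMap.le_opNorm _ _).trans (by gcongr)
  exact le_of_mul_le_mul_right (h1.trans h2) hpos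

theorem bddAbove_singularSet (T : E →L[ℂ] G) (n : ℕ) : BddAbove (singularSet T n) :=
  ⟨‖T‖, fun _ ht => le_of_mem_singularSet (rankApprox_norm T n) ht⟩

theorem singularValue_le {T : E →L[ℂ] G} {n : ℕ} {r : ℝ} (h : RankApprox T n r) :
    singularValue T n ≤ r :=
  Real.sSup_le (fun _ ht => le_of_mem_singularSet h ht) h.nonneg

theorem zero_mem_singularSet {T : E →L[ℂ] G} {n : ℕ} (h : (singularSet T n).Nonempty) :
    (0 : ℝ) ∈ singularSet T n := by
  obtain ⟨t, e, he, hs⟩ := h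
  refine ⟨e, he, fun i => ?_⟩
  obtain ⟨s, _, hs⟩ := hs i
  exact ⟨s, eigenvalue_absOp_nonneg T (he.1 i) hs, hs⟩

theorem singularValue_nonneg (T : E →L[ℂ] G) (n : ℕ) : 0 ≤ singularValue T n := by
  rcases (singularSet T n).eq_empty_or_nonempty with h | h
  -- Without `n + 1` orthonormal eigenvectors the set is empty, and `sSup ∅ = 0`.
  · change 0 ≤ sSup (singularSet T n)
    simp [h]
  · exact Real.sSup_nonneg' ⟨0, zero_mem_singularSet h, le_rfl⟩

theorem singularValue_antitone (T : E →L[ℂ] G) : Antitone (singularValue T) := by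
  intro n n' hn
  refine Real.sSup_le (fun t ht => le_csSup (bddAbove_singularSet T n) ?_)
    (singularValue_nonneg T n)
  obtain ⟨e, he, hs⟩ := ht
  exact ⟨e ∘ Fin.castLE (by omega), he.comp _ (Fin.castLE_injective _), fun i => hs _⟩

/-- If `|T|² x = s² x` with `s > 0` then `|T| x = s x`. -/
theorem absOp_apply_of_adjoint_comp {T : E →L[ℂ] G} {x : E} {s : ℝ} (hs : 0 < s)
    (h : ContinuousLinearMap.adjoint T (T x) = ((s ^ 2 : ℝ) : ℂ) • x) :
    absOp T x = (s : ℂ) • x := by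
  set y := absOp T x - (s : ℂ) • x with hy
  have h2 : absOp T (absOp T x) = ContinuousLinearMap.adjoint T (T x) :=
    DFunLike.congr_fun (absOp_comp_absOp T) x
  -- This is `(|T| + s)(|T| - s) x = 0`. A nonzero `y` would be an eigenvector of the positive
  -- operator `|T|` with eigenvalue `-s < 0`.
  have h3 : absOp T y = ((-s : ℝ) : ℂ) • y := by
    rw [hy, map_sub, map_smul, h2, h, smul_sub, smul_smul, sub_eq_sub_iff_add_eq_add]
    push_cast
    module
  have h4 := (absOp_isPositive T).re_inner_nonneg_right y
  rw [h3, inner_smul_right, inner_self_eq_norm_sq_to_K] at h4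
  have h5 : 0 ≤ -s * ‖y‖ ^ 2 := by
    have h : ((((-s : ℝ) : ℂ) * ((‖y‖ : ℝ) : ℂ) ^ 2)).re = -s * ‖y‖ ^ 2 := by
      rw [← Complex.ofReal_pow, ← Complex.ofReal_mul, Complex.ofReal_re]
    exact h ▸ h4
  have h6 : y = 0 := by
    by_contra hne
    have : 0 < ‖y‖ := norm_pos_iff.2 hne
    nlinarith [mul_pos hs (pow_pos this 2)]
  exact sub_eq_zero.1 h6

/-- A nonzero operator `Q* Q` with `Q` compact has the eigenvalue `‖Q‖²`. -/
theorem exists_eigenvector_adjoint_comp_self {Q : E →L[ℂ] G} (hQ : IsCompactOperator Q)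
    (h0 : Q ≠ 0) :
    ∃ x : E, ‖x‖ = 1 ∧ ContinuousLinearMap.adjoint Q (Q x) = ((‖Q‖ ^ 2 : ℝ) : ℂ) • x := by
  set A : E →L[ℂ] E := ContinuousLinearMap.adjoint Q ∘L Q with hA
  have hnA : ‖A‖ = ‖Q‖ ^ 2 := by
    rw [hA, ContinuousLinearMap.norm_adjoint_comp_self, sq]
  have hnpos : 0 < ‖Q‖ := norm_pos_iff.2 h0
  have hcpt : IsCompactOperator A :=
    hQ.clm_comp (ContinuousLinearMap.adjoint Q)
  have hsa : IsSelfAdjoint A := Q.isPositive_adjoint_comp_self.isSelfAdjoint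
  have : Nontrivial E := by
    by_contra h
    rw [not_nontrivial_iff_subsingleton] at h
    exact h0 (ContinuousLinearMap.ext fun x => by rw [Subsingleton.elim x 0, map_zero, map_zero])
  -- The spectral radius of the self-adjoint `A` is `‖A‖` and is attained; by compactness the
  -- nonzero spectral value `z` is an eigenvalue.
  obtain ⟨z, hz, hzn⟩ := spectrum.exists_nnnorm_eq_spectralRadius (A := E →L[ℂ] E) A
  rw [IsSelfAdjoint.spectralRadius_eq_nnnorm hsa] at hzn
  have hzn' : ‖z‖ = ‖Q‖ ^ 2 := by
    rw [← hnA]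
    have : ‖z‖₊ = ‖A‖₊ := by exact_mod_cast hzn
    exact congrArg NNReal.toReal this
  have hz0 : z ≠ 0 := by
    rw [← norm_pos_iff, hzn']; positivity
  have hev := (hcpt.hasEigenvalue_iff_mem_spectrum hz0).2 hz
  obtain ⟨x, hx⟩ := hev.exists_hasEigenvector
  have hx0 : x ≠ 0 := hx.2
  have hAx : ContinuousLinearMap.adjoint Q (Q x) = z • x := hx.apply_eq_smul
  -- Pairing `Q* Q x = z x` with `x` shows that `z` is a nonnegative real, so `|z| = ‖Q‖²`
  -- determines it.
  have h1 : z * ((‖x‖ ^ 2 : ℝ) : ℂ) = ((‖Q x‖ ^ 2 : ℝ) : ℂ) := by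
    have h := congrArg (fun y => inner ℂ x y) hAx
    simp only [ContinuousLinearMap.adjoint_inner_right, inner_smul_right,
      inner_self_eq_norm_sq_to_K] at h
    push_cast
    exact h.symm
  have hxpos : 0 < ‖x‖ := norm_pos_iff.2 hx0
  have h2 : z = ((‖Q x‖ ^ 2 / ‖x‖ ^ 2 : ℝ) : ℂ) := by
    push_cast at h1 ⊢
    rw [eq_div_iff (by exact_mod_cast (pow_pos hxpos 2).ne'), h1]
  have h3 : z = ((‖Q‖ ^ 2 : ℝ) : ℂ) := by
    rw [h2, Complex.norm_real, Real.norm_of_nonneg (by positivity)] at hzn'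
    rw [h2, hzn']
  refine ⟨((‖x‖⁻¹ : ℝ) : ℂ) • x, ?_, ?_⟩
  · rw [norm_smul, Complex.norm_real, norm_inv, norm_norm, inv_mul_cancel₀ hxpos.ne']
  · rw [map_smul, map_smul, hAx, h3, smul_comm]

/-- If no operator of rank at most `n` is that close, `n + 1` orthonormal eigenvectors of `|T|` with
eigenvalues above `singularValue T n` can be built one at a time: when `k ≤ n` of them span `V`, the
remainder `Q = T(1 - P_V)` has norm above that value, and its top singular vector is the next one.
The least of the `n + 1` eigenvalues then contradicts the supremum. -/
theorem rankApprox_singularValue {T : E →L[ℂ] G} (hT : IsCompactOperator T) (n : ℕ) :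
    RankApprox T n (singularValue T n) := by
  by_contra hcon
  have key : ∀ k ≤ n + 1, ∃ e : Fin k → E, Orthonormal ℂ e ∧
      ∀ i, ∃ s : ℝ, singularValue T n < s ∧ absOp T (e i) = (s : ℂ) • e i := by
    intro k
    induction k with
    | zero => exact fun _ => ⟨Fin.elim0, ⟨fun i => i.elim0, fun i => i.elim0⟩, fun i => i.elim0⟩
    | succ k ih =>
      intro hk
      obtain ⟨e, he, hs⟩ := ih (by omega)
      choose s hs hes using hs
      let V : Submodule ℂ E := Submodule.span ℂ (Set.range e)
      have : FiniteDimensional ℂ V := FiniteDimensional.span_of_finite ℂ (Set.finite_range e)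
      have hVrank : Module.rank ℂ V ≤ n := by
        rw [← Module.finrank_eq_rank ℂ V, Nat.cast_le]
        refine (finrank_range_le_card e).trans ?_
        rw [Fintype.card_fin]
        omega
      set R : E →L[ℂ] G := T ∘L V.starProjection with hR
      have hRrank : (R : E →ₗ[ℂ] G).rank ≤ n := by
        refine rank_comp_le_of_right T ?_
        refine (Submodule.rank_mono ?_).trans hVrank
        rintro _ ⟨y, rfl⟩
        exact V.starProjection_apply_mem y
      set Q := T - R with hQ
      have hQn : singularValue T n < ‖Q‖ := by
        by_contra! h
        exact hcon ⟨R, hRrank, h⟩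
      have hQc : IsCompactOperator Q := hT.sub (hT.comp_clm V.starProjection)
      have hQ0 : Q ≠ 0 := by
        rintro h
        rw [h, norm_zero] at hQn
        exact absurd (singularValue_nonneg T n) (not_le.2 hQn)
      obtain ⟨x, hx1, hx⟩ := exists_eigenvector_adjoint_comp_self hQc hQ0
      have hQpos : 0 < ‖Q‖ := norm_pos_iff.2 hQ0
      -- `Q` kills each `e i`, whereas `x` is an eigenvector of `Q* Q` with nonzero eigenvalue, so
      -- `x ⟂ e i`.
      have hxe : ∀ i, inner ℂ (e i) x = 0 := by
        intro i
        have heV : V.starProjection (e i) = e i :=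
          Submodule.starProjection_eq_self_iff.2 (Submodule.subset_span ⟨i, rfl⟩)
        have hQe : Q (e i) = 0 := by
          rw [hQ, sub_apply, hR, ContinuousLinearMap.comp_apply, heV, sub_self]
        have h := congrArg (fun y => inner ℂ (e i) y) hx
        simp only [ContinuousLinearMap.adjoint_inner_right, hQe, inner_zero_left,
          inner_smul_right] at h
        exact (mul_eq_zero.1 h.symm).resolve_left
          (Complex.ofReal_ne_zero.2 (pow_pos hQpos 2).ne')
      have hxV : x ∈ Vᗮ := by
        rw [Submodule.mem_orthogonal]
        intro y hy
        induction hy using Submodule.span_induction with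
        | mem y h => obtain ⟨i, rfl⟩ := h; exact hxe i
        | zero => exact inner_zero_left x
        | add y z _ _ hy hz => rw [inner_add_left, hy, hz, add_zero]
        | smul a y _ hy => rw [inner_smul_left, hy, mul_zero]
      have hPx : V.starProjection x = 0 := V.starProjection_apply_eq_zero_iff.2 hxV
      have hTx : Q x = T x := by
        rw [hQ, sub_apply, hR, ContinuousLinearMap.comp_apply, hPx, map_zero,
          sub_zero]
      have hTTx : ContinuousLinearMap.adjoint T (T x) = ((‖Q‖ ^ 2 : ℝ) : ℂ) • x := by
        have hTTe : ∀ i, ContinuousLinearMap.adjoint T (T (e i)) =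
            ((s i : ℂ) * s i) • e i := by
          intro i
          rw [← ContinuousLinearMap.comp_apply, ← absOp_comp_absOp, ContinuousLinearMap.comp_apply,
            hes, map_smul, hes, smul_smul]
        -- `V` is spanned by eigenvectors of the self-adjoint `T* T`, so `Vᗮ` is invariant as well.
        -- Hence the projection in `Q* = (1 - P_V) T*` has no effect on `T x`.
        have hmem : ContinuousLinearMap.adjoint T (T x) ∈ Vᗮ := by
          rw [Submodule.mem_orthogonal]
          intro y hy
          induction hy using Submodule.span_induction with
          | mem y h =>
            obtain ⟨i, rfl⟩ := h
            rw [ContinuousLinearMap.adjoint_inner_right, ← ContinuousLinearMap.adjoint_inner_left,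
              hTTe, inner_smul_left, hxe, mul_zero]
          | zero => exact inner_zero_left _
          | add y z _ _ hy hz => rw [inner_add_left, hy, hz, add_zero]
          | smul a y _ hy => rw [inner_smul_left, hy, mul_zero]
        have hadj : ContinuousLinearMap.adjoint Q (Q x) = ContinuousLinearMap.adjoint T (T x) := by
          rw [hTx]
          refine ext_inner_left ℂ fun y => ?_
          have h0 : inner ℂ (V.starProjection y) (ContinuousLinearMap.adjoint T (T x)) = 0 :=
            (Submodule.mem_orthogonal _ _).1 hmem _ (V.starProjection_apply_mem y)
          rw [ContinuousLinearMap.adjoint_inner_right] at h0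
          rw [ContinuousLinearMap.adjoint_inner_right, ContinuousLinearMap.adjoint_inner_right, hQ,
            sub_apply, hR, ContinuousLinearMap.comp_apply, inner_sub_left, h0,
            sub_zero]
        rw [← hadj, hx]
      refine ⟨Matrix.vecCons x e, orthonormal_vecCons_iff.2 ⟨hx1, ?_, he⟩, ?_⟩
      · intro i
        rw [← inner_conj_symm, hxe, map_zero]
      · intro i
        refine Fin.cases ?_ (fun j => ?_) i
        · exact ⟨‖Q‖, hQn, absOp_apply_of_adjoint_comp hQpos hTTx⟩
        · exact ⟨s j, hs j, hes j⟩
  obtain ⟨e, he, hs⟩ := key (n + 1) le_rfl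
  choose s hs hes using hs
  obtain ⟨i₀, hi₀⟩ := Finite.exists_min s
  exact absurd (le_csSup (bddAbove_singularSet T n) ⟨e, he, fun i => ⟨s i, hi₀ i, hes i⟩⟩)
    (not_le.2 (hs i₀))

end SingularValues

/-! ### Antitone summable sequences -/

section Summability

theorem summable_nat_half {a : ℕ → ℝ} (h : Summable a) : Summable fun n => a (n / 2) := by
  have h0 : (fun n => a ((2 * n) / 2)) = a := funext fun n => by congr 1; omega
  have h1 : (fun n => a ((2 * n + 1) / 2)) = a := funext fun n => by congr 1; omega
  exact (HasSum.even_add_odd (f := fun n => a (n / 2)) (h0 ▸ h.hasSum) (h1 ▸ h.hasSum)).summable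

theorem nonneg_of_antitone_of_summable {e : ℕ → ℝ} (he : Antitone e) (hs : Summable e) (n : ℕ) :
    0 ≤ e n :=
  he.le_of_tendsto hs.tendsto_atTop_zero n

/-- Cauchy condensation in quantitative form; it sums the dyadic blocks in the estimate of the
trace. -/
theorem sum_two_pow_mul_le {e : ℕ → ℝ} (he : Antitone e) (hs : Summable e) (n : ℕ) :
    ∑ k ∈ Finset.range n, 2 ^ k * e (2 ^ k) ≤ 2 * ∑' k, e k := by
  have h0 := nonneg_of_antitone_of_summable he hs
  have h1 := Finset.sum_condensed_le (f := e) (fun _ _ _ h => he h) n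
  simp only [nsmul_eq_mul, Nat.cast_pow, Nat.cast_ofNat] at h1
  have h2 : ∑ k ∈ Finset.range n, 2 ^ k * e (2 ^ k) ≤
      ∑ k ∈ Finset.range (n + 1), 2 ^ k * e (2 ^ k) :=
    Finset.sum_le_sum_of_subset_of_nonneg (Finset.range_mono n.le_succ)
      fun i _ _ => mul_nonneg (by positivity) (h0 _)
  have h3 : e 1 + ∑ k ∈ Finset.Ico 2 (2 ^ n + 1), e k ≤ ∑' k, e k := by
    rw [← Finset.sum_insert (by simp)]
    exact hs.sum_le_tsum _ fun i _ => h0 i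
  linarith [h0 1]

/-- Two antitone sequences in `ℓ^N` are dominated by a common one. -/
theorem exists_common_majorant {N : ℕ} {c d : ℕ → ℝ} (hc : Antitone c) (hc0 : ∀ n, 0 ≤ c n)
    (hcs : Summable fun n => c n ^ N) (hd : Antitone d) (hd0 : ∀ n, 0 ≤ d n)
    (hds : Summable fun n => d n ^ N) :
    ∃ a : ℕ → ℝ, Antitone a ∧ (∀ n, 0 ≤ a n) ∧ (Summable fun n => a n ^ N) ∧
      (∀ n, c n ≤ a n) ∧ ∀ n, d n ≤ a n := by
  refine ⟨fun n => max (c n) (d n), hc.sup hd, fun n => (hc0 n).trans (le_max_left _ _), ?_,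
    fun n => le_max_left _ _, fun n => le_max_right _ _⟩
  refine Summable.of_nonneg_of_le (fun n => pow_nonneg ((hc0 n).trans (le_max_left _ _)) N)
    (fun n => ?_) (hcs.add hds)
  change max (c n) (d n) ^ N ≤ c n ^ N + d n ^ N
  rcases max_choice (c n) (d n) with h | h <;> rw [h]
  · exact le_add_of_nonneg_right (pow_nonneg (hd0 n) N)
  · exact le_add_of_nonneg_left (pow_nonneg (hc0 n) N)

end Summability

/-! ### Schatten classes as powers of one sequence -/

section PowApprox

variable {E G K : Type w} [NormedAddCommGroup E] [InnerProductSpace ℂ E]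
  [NormedAddCommGroup G] [InnerProductSpace ℂ G] [NormedAddCommGroup K] [InnerProductSpace ℂ K]

/-- The approximation numbers of `T` are dominated by `C c^k` for an antitone sequence `c` of
class `ℓ^N`; for `k > 0` this says that `T` lies in the Schatten class of exponent `N / k`. -/
def PowApprox (N k : ℕ) (T : E →L[ℂ] G) : Prop :=
  ∃ (c : ℕ → ℝ) (B : ℝ), Antitone c ∧ (∀ n, 0 ≤ c n) ∧ 0 ≤ B ∧ (Summable fun n => c n ^ N) ∧
    ∀ n, RankApprox T n (B * c n ^ k)

theorem PowApprox.common {E' G' : Type w} [NormedAddCommGroup E'] [InnerProductSpace ℂ E']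
    [NormedAddCommGroup G'] [InnerProductSpace ℂ G'] {N k l : ℕ}
    {S : E →L[ℂ] G} {T : E' →L[ℂ] G'} (hS : PowApprox N k S) (hT : PowApprox N l T) :
    ∃ (a : ℕ → ℝ) (B : ℝ), Antitone a ∧ (∀ n, 0 ≤ a n) ∧ 0 ≤ B ∧ (Summable fun n => a n ^ N) ∧
      (∀ n, RankApprox S n (B * a n ^ k)) ∧ ∀ n, RankApprox T n (B * a n ^ l) := by
  obtain ⟨c, B, hc, hc0, hB, hcs, hS⟩ := hS
  obtain ⟨d, B', hd, hd0, hB', hds, hT⟩ := hT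
  obtain ⟨a, ha, ha0, has, hca, hda⟩ := exists_common_majorant hc hc0 hcs hd hd0 hds
  refine ⟨a, max B B', ha, ha0, hB.trans (le_max_left _ _), has,
    fun n => (hS n).mono le_rfl ?_, fun n => (hT n).mono le_rfl ?_⟩
  · exact mul_le_mul (le_max_left _ _) (pow_le_pow_left₀ (hc0 n) (hca n) k)
      (pow_nonneg (hc0 n) k) (hB.trans (le_max_left _ _))
  · exact mul_le_mul (le_max_right _ _) (pow_le_pow_left₀ (hd0 n) (hda n) l)
      (pow_nonneg (hd0 n) l) (hB.trans (le_max_left _ _))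

theorem antitone_half {a : ℕ → ℝ} (ha : Antitone a) : Antitone fun n => a (n / 2) :=
  fun _ _ h => ha (Nat.div_le_div_right h)

theorem PowApprox.add {N k : ℕ} {S T : E →L[ℂ] G} (hS : PowApprox N k S)
    (hT : PowApprox N k T) : PowApprox N k (S + T) := by
  obtain ⟨a, B, ha, ha0, hB, has, hS, hT⟩ := hS.common hT
  refine ⟨fun n => a (n / 2), B + B, antitone_half ha, fun n => ha0 _, by positivity,
    summable_nat_half has, fun n => ?_⟩
  rw [add_mul]
  -- The rank `n` is shared as `n / 2` for each summand, hence the sequence `a (n / 2)`, which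
  -- repeats every value of `a` twice.
  exact ((hS (n / 2)).add (hT (n / 2))).mono (by omega) le_rfl

theorem PowApprox.comp {N k l : ℕ} {S : G →L[ℂ] K} {T : E →L[ℂ] G} (hS : PowApprox N k S)
    (hT : PowApprox N l T) : PowApprox N (k + l) (S ∘L T) := by
  obtain ⟨a, B, ha, ha0, hB, has, hS, hT⟩ := hS.common hT
  refine ⟨fun n => a (n / 2), B * B, antitone_half ha, fun n => ha0 _, by positivity,
    summable_nat_half has, fun n => ?_⟩
  rw [pow_add, mul_mul_mul_comm]
  exact ((hS (n / 2)).comp (hT (n / 2))).mono (by omega) le_rfl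

theorem PowApprox.smul {N k : ℕ} (a : ℂ) {T : E →L[ℂ] G} (hT : PowApprox N k T) :
    PowApprox N k (a • T) := by
  obtain ⟨c, B, hc, hc0, hB, hcs, hT⟩ := hT
  refine ⟨c, ‖a‖ * B, hc, hc0, by positivity, hcs, fun n => ?_⟩
  rw [mul_assoc]
  exact (hT n).smul a

theorem powApprox_zero_op {N : ℕ} (hN : N ≠ 0) (k : ℕ) : PowApprox N k (0 : E →L[ℂ] G) := by
  refine ⟨fun _ => 0, 0, antitone_const, fun _ => le_rfl, le_rfl, ?_, fun n => ?_⟩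
  · simp [hN, summable_zero]
  · rw [zero_mul]
    exact ⟨0, by simp, by simp⟩

theorem powApprox_bounded {N : ℕ} (hN : N ≠ 0) (T : E →L[ℂ] G) : PowApprox N 0 T := by
  -- Since `0 ^ 0 = 1`, the zero sequence gives the constant bound `‖T‖`, while `N ≠ 0` keeps `0 ^
  -- N` summable.
  refine ⟨fun _ => 0, ‖T‖, antitone_const, fun _ => le_rfl, norm_nonneg _, ?_, fun n => ?_⟩
  · simp [hN, summable_zero]
  · rw [pow_zero, mul_one]
    exact rankApprox_norm T n

theorem PowApprox.bounded_comp {N k : ℕ} (hN : N ≠ 0) (S : G →L[ℂ] K) {T : E →L[ℂ] G}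
    (hT : PowApprox N k T) : PowApprox N k (S ∘L T) := by
  have := (powApprox_bounded hN S).comp hT
  rwa [Nat.zero_add] at this

/-- The approximation numbers of `T` are dominated by an antitone summable sequence. -/
def TraceClass (T : E →L[ℂ] G) : Prop :=
  ∃ e : ℕ → ℝ, Antitone e ∧ Summable e ∧ ∀ n, RankApprox T n (e n)

theorem PowApprox.traceClass {N : ℕ} {T : E →L[ℂ] G} (hT : PowApprox N N T) : TraceClass T := by
  obtain ⟨c, B, hc, hc0, hB, hcs, hT⟩ := hT
  exact ⟨fun n => B * c n ^ N,
    fun _ n h => mul_le_mul_of_nonneg_left (pow_le_pow_left₀ (hc0 n) (hc h) N) hB,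
    hcs.mul_left B, hT⟩

variable [CompleteSpace E] [CompleteSpace G]

theorem IsSchatten.powApprox {T : E →L[ℂ] G} {p : ℝ} (hp : 1 ≤ p) (hT : IsSchatten p T) {N : ℕ}
    (hN : p ≤ N) : PowApprox N 1 T := by
  obtain ⟨hc, hs⟩ := hT
  have h0 := singularValue_nonneg T
  refine ⟨singularValue T, 1, singularValue_antitone T, h0, zero_le_one, ?_, fun n => ?_⟩
  · refine hs.of_norm_bounded_eventually_nat ?_
    -- Summability forces the singular values eventually below `1`, where raising the exponent from
    -- `p` to `N` only decreases the terms.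
    filter_upwards [hs.tendsto_atTop_zero.eventually (gt_mem_nhds zero_lt_one)] with n hn
    have h1 : singularValue T n ≤ 1 := by
      by_contra! h
      exact absurd hn (not_lt.2 (Real.one_le_rpow h.le (by linarith)))
    rw [Real.norm_of_nonneg (pow_nonneg (h0 n) N), ← Real.rpow_natCast]
    exact Real.rpow_le_rpow_of_exponent_ge_of_imp (h0 n) h1 hN fun _ h => by linarith
  · rw [one_mul, pow_one]
    exact rankApprox_singularValue hc n

theorem TraceClass.isSchatten {T : E →L[ℂ] G} (hT : TraceClass T) (hc : IsCompactOperator T) :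
    IsSchatten 1 T := by
  obtain ⟨e, _, hes, hT⟩ := hT
  refine ⟨hc, ?_⟩
  simp only [Real.rpow_one]
  exact Summable.of_nonneg_of_le (singularValue_nonneg T) (fun n => singularValue_le (hT n)) hes

end PowApprox

/-! ### The trace: absolute convergence and `Tr(AB) = Tr(BA)` -/

section Trace

variable {E G : Type w} [NormedAddCommGroup E] [InnerProductSpace ℂ E]
  [NormedAddCommGroup G] [InnerProductSpace ℂ G]

/-- For `k ≤ n / 2`, subtracting `R (n - k) - R k` costs rank at most `n` and leaves `A - R (n -
k)`, with `n - k ≥ n / 2`; otherwise `0` is a good enough approximant. The bounds are dominated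
uniformly in `k` and tend to `0` with `r` as `k → ∞`. -/
theorem rankApprox_sub {A : E →L[ℂ] G} {R : ℕ → E →L[ℂ] G} {r : ℕ → ℝ} (hr : Antitone r)
    (hR : ∀ n, (R n : E →ₗ[ℂ] G).rank ≤ n) (hAR : ∀ n, ‖A - R n‖ ≤ r n) (k n : ℕ) :
    RankApprox (A - R k) n (r (max k (n / 2))) := by
  rcases le_total k (n / 2) with h | h
  · rw [max_eq_right h]
    refine ⟨R (n - k) - R k, ?_, ?_⟩
    · rw [sub_eq_add_neg]
      refine (rank_add_le (hR (n - k)) (rank_neg_le (hR k))).trans ?_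
      exact_mod_cast (by omega : n - k + k ≤ n)
    · rw [sub_sub_sub_cancel_right]
      exact (hAR _).trans (hr (by omega))
  · rw [max_eq_left h]
    exact ⟨0, by simp, by simpa using hAR k⟩

variable {ι : Type*} (b : HilbertBasis ι ℂ E)

/-- The sum of the absolute values of some diagonal entries. -/
def diagSum (s : Finset ι) (T : E →L[ℂ] E) : ℝ := ∑ i ∈ s, ‖inner ℂ (b i) (T (b i))‖

theorem diagSum_add_le (s : Finset ι) (S T : E →L[ℂ] E) :
    diagSum b s (S + T) ≤ diagSum b s S + diagSum b s T := by
  unfold diagSum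
  rw [← Finset.sum_add_distrib]
  refine Finset.sum_le_sum fun i _ => ?_
  rw [add_apply, inner_add_right]
  exact norm_add_le _ _

theorem diagSum_le_card_mul (s : Finset ι) (T : E →L[ℂ] E) : diagSum b s T ≤ s.card * ‖T‖ := by
  unfold diagSum
  rw [← nsmul_eq_mul]
  refine Finset.sum_le_card_nsmul s _ _ fun i _ => ?_
  have h1 : ‖b i‖ = 1 := b.orthonormal.1 i
  refine (norm_inner_le_norm _ _).trans ?_
  rw [h1, one_mul]
  refine (T.le_opNorm _).trans ?_
  rw [h1, mul_one]

variable [CompleteSpace E] [CompleteSpace G]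

theorem exists_rank_one_decomposition {R : E →L[ℂ] G} {n : ℕ}
    (hR : (R : E →ₗ[ℂ] G).rank ≤ n) :
    ∃ r ≤ n, ∃ (u : Fin r → E) (v : Fin r → G), Orthonormal ℂ v ∧ (∀ j, ‖u j‖ ≤ ‖R‖) ∧
      ∀ x, R x = ∑ j, inner ℂ (u j) x • v j := by
  let V : Submodule ℂ G := LinearMap.range (R : E →ₗ[ℂ] G)
  have hV : Module.rank ℂ V ≤ n := hR
  have : FiniteDimensional ℂ V :=
    Module.rank_lt_aleph0_iff.1 (hV.trans_lt (Cardinal.natCast_lt_aleph0))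
  let q := stdOrthonormalBasis ℂ V
  -- With `v` an orthonormal basis of the range, `u j = R* (v j)`.
  refine ⟨Module.finrank ℂ V, Module.finrank_le_of_rank_le hV,
    fun j => ContinuousLinearMap.adjoint R (q j), fun j => q j, ?_, fun j => ?_, fun x => ?_⟩
  · exact q.orthonormal.comp_linearIsometry V.subtypeₗᵢ
  · refine (ContinuousLinearMap.le_opNorm _ _).trans ?_
    have : ‖((q j : V) : G)‖ = 1 := q.orthonormal.1 j
    rw [this, mul_one, LinearIsometryEquiv.norm_map]
  · have h := congrArg (Subtype.val) (q.sum_repr' ⟨R x, x, rfl⟩)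
    simp only [ContinuousLinearMap.adjoint_inner_left]
    rw [Submodule.coe_sum] at h
    exact h.symm

/-- Each rank-one piece contributes at most `‖u j‖ ‖v j‖` by Cauchy–Schwarz and Bessel,
independently of `s`. -/
theorem diagSum_le_rank_mul (s : Finset ι) {R : E →L[ℂ] E} {n : ℕ}
    (hR : (R : E →ₗ[ℂ] E).rank ≤ n) : diagSum b s R ≤ n * ‖R‖ := by
  obtain ⟨r, hr, u, v, hv, hu, h⟩ := exists_rank_one_decomposition hR
  have hterm : ∀ j, ∑ i ∈ s, ‖inner ℂ (u j) (b i)‖ * ‖inner ℂ (b i) (v j)‖ ≤ ‖R‖ := by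
    intro j
    refine (Real.sum_mul_le_sqrt_mul_sqrt s _ _).trans ?_
    have h1 : √(∑ i ∈ s, ‖inner ℂ (u j) (b i)‖ ^ 2) ≤ ‖u j‖ := by
      refine Real.sqrt_le_iff.2 ⟨norm_nonneg _, ?_⟩
      simp only [norm_inner_symm (u j)]
      exact b.orthonormal.sum_inner_products_le (u j)
    have h2 : √(∑ i ∈ s, ‖inner ℂ (b i) (v j)‖ ^ 2) ≤ ‖v j‖ :=
      Real.sqrt_le_iff.2 ⟨norm_nonneg _, b.orthonormal.sum_inner_products_le (v j)⟩
    rw [hv.1 j] at h2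
    calc _ ≤ ‖u j‖ * 1 := mul_le_mul h1 h2 (Real.sqrt_nonneg _) (norm_nonneg _)
      _ ≤ ‖R‖ := by rw [mul_one]; exact hu j
  calc diagSum b s R
      ≤ ∑ i ∈ s, ∑ j, ‖inner ℂ (u j) (b i)‖ * ‖inner ℂ (b i) (v j)‖ := by
        refine Finset.sum_le_sum fun i _ => ?_
        rw [h, inner_sum]
        refine (norm_sum_le _ _).trans (Finset.sum_le_sum fun j _ => ?_)
        rw [inner_smul_right, norm_mul]
    _ = ∑ j, ∑ i ∈ s, ‖inner ℂ (u j) (b i)‖ * ‖inner ℂ (b i) (v j)‖ := Finset.sum_comm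
    _ ≤ ∑ _j : Fin r, ‖R‖ := Finset.sum_le_sum fun j _ => hterm j
    _ = r * ‖R‖ := by simp
    _ ≤ n * ‖R‖ := by gcongr

/-- Dyadic telescoping of `T` along `R (2 ^ k)`: consecutive differences have rank at most `3 · 2 ^
k` and norm at most `2 e (2 ^ k)`. Condensation bounds their sum by `12 ∑ e`, and the start `R 1`
adds `2 e 0`, whence `14`. -/
theorem diagSum_le_tsum (s : Finset ι) {T : E →L[ℂ] E} {e : ℕ → ℝ} (he : Antitone e)
    (hes : Summable e) (hT : ∀ n, RankApprox T n (e n)) :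
    diagSum b s T ≤ 14 * ∑' n, e n := by
  have he0 := nonneg_of_antitone_of_summable he hes
  choose R hR hTR using hT
  have hsub : ∀ n n', n' ≤ n → diagSum b s (R n - R n') ≤ (n + n' : ℕ) * (2 * e n') := by
    intro n n' hn
    have hrank : ((R n - R n' : E →L[ℂ] E) : E →ₗ[ℂ] E).rank ≤ (n + n' : ℕ) := by
      rw [sub_eq_add_neg]
      exact rank_add_le (hR n) (rank_neg_le (hR n'))
    refine (diagSum_le_rank_mul b s hrank).trans ?_
    gcongr
    have h : R n - R n' = (T - R n') - (T - R n) := by abel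
    rw [h]
    refine (norm_sub_le _ _).trans ?_
    linarith [hTR n, hTR n', he hn]
  have hstep : ∀ n n', n' ≤ n →
      diagSum b s (R n) ≤ diagSum b s (R n') + (n + n' : ℕ) * (2 * e n') := by
    intro n n' hn
    have h := diagSum_add_le b s (R n') (R n - R n')
    rw [add_sub_cancel] at h
    exact h.trans (add_le_add le_rfl (hsub n n' hn))
  have hpow : ∀ k, diagSum b s (R (2 ^ k)) ≤
      2 * e 0 + 6 * ∑ i ∈ Finset.range k, 2 ^ i * e (2 ^ i) := by
    intro k
    induction k with
    | zero =>
      have h0 := diagSum_le_rank_mul b s (hR 0)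
      have h1 := hstep 1 0 zero_le_one
      simp only [Nat.cast_zero, zero_mul] at h0
      simp only [pow_zero, Finset.range_zero, Finset.sum_empty]
      norm_num at h1 ⊢
      linarith
    | succ k ih =>
      have h := hstep (2 ^ (k + 1)) (2 ^ k) (Nat.pow_le_pow_right two_pos k.le_succ)
      rw [Finset.sum_range_succ]
      push_cast at h
      rw [pow_succ (2 : ℝ)] at h
      linarith
  -- The remainder is estimated crudely by the size of `s`; for fixed `s` it vanishes as `k → ∞`.
  have hbound : ∀ k, diagSum b s T ≤ s.card * e (2 ^ k) + 14 * ∑' n, e n := by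
    intro k
    have h1 := diagSum_add_le b s (T - R (2 ^ k)) (R (2 ^ k))
    rw [sub_add_cancel] at h1
    have h2 := diagSum_le_card_mul b s (T - R (2 ^ k))
    have h3 : (s.card : ℝ) * ‖T - R (2 ^ k)‖ ≤ s.card * e (2 ^ k) := by
      gcongr
      exact hTR _
    have h4 := hpow k
    have h5 := sum_two_pow_mul_le he hes k
    have h6 : e 0 ≤ ∑' n, e n := hes.le_tsum 0 fun i _ => he0 i
    linarith
  have hlim : Filter.Tendsto (fun k : ℕ => (s.card : ℝ) * e (2 ^ k) + 14 * ∑' n, e n)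
      Filter.atTop (nhds ((s.card : ℝ) * 0 + 14 * ∑' n, e n)) :=
    ((hes.tendsto_atTop_zero.comp
      (tendsto_pow_atTop_atTop_of_one_lt one_lt_two)).const_mul _).add_const _
  rw [mul_zero, zero_add] at hlim
  exact ge_of_tendsto' hlim hbound

theorem TraceClass.summable_diag {T : E →L[ℂ] E} (hT : TraceClass T) :
    Summable fun i => inner ℂ (b i) (T (b i)) := by
  obtain ⟨e, he, hes, hT⟩ := hT
  exact Summable.of_norm (summable_of_sum_le (fun _ => norm_nonneg _)
    fun s => diagSum_le_tsum b s he hes hT)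

theorem norm_trace_le {T : E →L[ℂ] E} {e : ℕ → ℝ} (he : Antitone e)
    (hes : Summable e) (hT : ∀ n, RankApprox T n (e n)) : ‖trace T‖ ≤ 14 * ∑' n, e n :=
  tsum_of_norm_bounded (summable_of_sum_le (fun _ => norm_nonneg _)
    fun s => diagSum_le_tsum _ s he hes hT).hasSum (fun _ => le_rfl) |>.trans
    (Real.tsum_le_of_sum_le (fun _ => norm_nonneg _) fun s => diagSum_le_tsum _ s he hes hT)

theorem trace_add {S T : E →L[ℂ] E} (hS : TraceClass S) (hT : TraceClass T) :
    trace (S + T) = trace S + trace T := by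
  unfold trace
  rw [← (hS.summable_diag _).tsum_add (hT.summable_diag _)]
  exact tsum_congr fun i => by rw [add_apply, inner_add_right]

theorem trace_smul (a : ℂ) (T : E →L[ℂ] E) : trace (a • T) = a * trace T := by
  unfold trace
  rw [← tsum_mul_left]
  exact tsum_congr fun i => by rw [smul_apply, inner_smul_right]

theorem trace_neg (T : E →L[ℂ] E) : trace (-T) = -trace T := by
  rw [← neg_one_smul ℂ T, trace_smul, neg_one_mul]

theorem trace_sub {S T : E →L[ℂ] E} (hS : TraceClass S) (hT : TraceClass T) :
    trace (S - T) = trace S - trace T := by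
  unfold trace
  rw [← (hS.summable_diag _).tsum_sub (hT.summable_diag _)]
  exact tsum_congr fun i => by rw [sub_apply, inner_sub_right]

theorem trace_eq_sum {T : E →L[ℂ] E} {r : ℕ} {u v : Fin r → E}
    (h : ∀ x, T x = ∑ j, inner ℂ (u j) x • v j) : trace T = ∑ j, inner ℂ (u j) (v j) := by
  set b := (exists_hilbertBasis ℂ E).choose_spec.choose with hb
  have h1 : HasSum (fun i => ∑ j, inner ℂ (u j) (b i) * inner ℂ (b i) (v j))
      (∑ j, inner ℂ (u j) (v j)) :=
    hasSum_sum fun j _ => b.hasSum_inner_mul_inner (u j) (v j)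
  unfold trace
  rw [← h1.tsum_eq]
  refine tsum_congr fun i => ?_
  rw [h, inner_sum]
  exact Finset.sum_congr rfl fun j _ => inner_smul_right _ _ _

theorem trace_comp_comm_of_rank {R : E →L[ℂ] G} {n : ℕ} (hR : (R : E →ₗ[ℂ] G).rank ≤ n)
    (B : G →L[ℂ] E) : trace (R ∘L B) = trace (B ∘L R) := by
  obtain ⟨r, _, u, v, _, _, h⟩ := exists_rank_one_decomposition hR
  rw [trace_eq_sum (T := R ∘L B) (u := fun j => ContinuousLinearMap.adjoint B (u j)) (v := v),
    trace_eq_sum (T := B ∘L R) (u := u) (v := fun j => B (v j))]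
  · simp only [ContinuousLinearMap.adjoint_inner_left]
  · intro x
    simp only [ContinuousLinearMap.comp_apply, h, map_sum, map_smul]
  · intro x
    simp only [ContinuousLinearMap.comp_apply, h, ContinuousLinearMap.adjoint_inner_left]

/-- The trace property `Tr(AB) = Tr(BA)` for `A` and `B` in Schatten classes of exponents `N / k`
and `N / l` with `k + l = N`. -/
theorem trace_comp_comm {N k l : ℕ} (hk : k ≠ 0) (hkl : k + l = N) {A : E →L[ℂ] G}
    {B : G →L[ℂ] E} (hA : PowApprox N k A) (hB : PowApprox N l B) :
    trace (A ∘L B) = trace (B ∘L A) := by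
  have hN : N ≠ 0 := by omega
  have hAB : TraceClass (A ∘L B) := PowApprox.traceClass (N := N) (hkl ▸ hA.comp hB)
  have hBA : TraceClass (B ∘L A) :=
    PowApprox.traceClass (N := N) (((add_comm l k).trans hkl) ▸ hB.comp hA)
  obtain ⟨a, M, ha, ha0, hM, has, hA, hB⟩ := hA.common hB
  choose R hR hAR using hA
  have hr : Antitone fun n => M * a n ^ k := fun m n h => by
    have := ha h
    have := ha0 n
    dsimp only
    gcongr
  -- `e K` bounds the approximation numbers of both `(A - R K) B` and `B (A - R K)`. One halving of
  -- `n` comes from composition, the other from `rankApprox_sub`; the bound for `B` is weakened to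
  -- match.
  let e : ℕ → ℕ → ℝ := fun K n => (M * a (max K (n / 2 / 2)) ^ k) * (M * a (n / 2 / 2) ^ l)
  have hM0 : ∀ n j, 0 ≤ M * a n ^ j := fun n j => mul_nonneg hM (pow_nonneg (ha0 n) j)
  have he : ∀ K, Antitone (e K) := by
    intro K m n h
    have h1 : m / 2 / 2 ≤ n / 2 / 2 := Nat.div_le_div_right (Nat.div_le_div_right h)
    refine mul_le_mul (hr (max_le_max le_rfl h1)) ?_ (hM0 _ _) (hM0 _ _)
    exact mul_le_mul_of_nonneg_left (pow_le_pow_left₀ (ha0 _) (ha h1) l) hM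
  have hbound : Summable fun n => M * M * a (n / 2 / 2) ^ N :=
    (summable_nat_half (summable_nat_half has)).mul_left (M * M)
  have hle : ∀ K n, ‖e K n‖ ≤ M * M * a (n / 2 / 2) ^ N := by
    intro K n
    rw [Real.norm_of_nonneg (mul_nonneg (hM0 _ _) (hM0 _ _)), ← hkl, pow_add, mul_mul_mul_comm M M]
    exact mul_le_mul_of_nonneg_right (hr (le_max_right _ _)) (hM0 _ _)
  have hes : ∀ K, Summable (e K) := fun K => hbound.of_norm_bounded (hle K)
  have hsub : ∀ K n, RankApprox (A - R K) n (M * a (max K (n / 2)) ^ k) :=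
    rankApprox_sub hr hR hAR
  have hB' : ∀ n, RankApprox B n (M * a (n / 2) ^ l) := fun n => (hB n).mono le_rfl
    (mul_le_mul_of_nonneg_left (pow_le_pow_left₀ (ha0 _) (ha (Nat.div_le_self n 2)) l) hM)
  have h1 : ∀ K n, RankApprox ((A - R K) ∘L B) n (e K n) := fun K n =>
    ((hsub K (n / 2)).comp (hB' (n / 2))).mono (by omega) le_rfl
  have h2 : ∀ K n, RankApprox (B ∘L (A - R K)) n (e K n) := fun K n =>
    ((hB' (n / 2)).comp (hsub K (n / 2))).mono (by omega) (mul_comm _ _).le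
  -- `R K` has finite rank, so replacing `A` by `A - R K` does not change `Tr(AB) - Tr(BA)`; each
  -- remaining trace costs `14 ∑ e K`.
  have hdiff : ∀ K, ‖trace (A ∘L B) - trace (B ∘L A)‖ ≤ 28 * ∑' n, e K n := by
    intro K
    have t1 : TraceClass ((A - R K) ∘L B) := ⟨e K, he K, hes K, h1 K⟩
    have t2 : TraceClass (B ∘L (A - R K)) := ⟨e K, he K, hes K, h2 K⟩
    have e1 : A ∘L B - (A - R K) ∘L B = R K ∘L B := by
      rw [ContinuousLinearMap.sub_comp, sub_sub_cancel]
    have e2 : B ∘L A - B ∘L (A - R K) = B ∘L R K := by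
      rw [ContinuousLinearMap.comp_sub, sub_sub_cancel]
    have e3 := trace_comp_comm_of_rank (hR K) B
    rw [← e1, ← e2, trace_sub hAB t1, trace_sub hBA t2] at e3
    have e4 : trace (A ∘L B) - trace (B ∘L A) =
        trace ((A - R K) ∘L B) - trace (B ∘L (A - R K)) := by linear_combination e3
    rw [e4]
    refine (norm_sub_le _ _).trans ?_
    linarith [norm_trace_le (he K) (hes K) (h1 K), norm_trace_le (he K) (hes K) (h2 K)]
  have ha_lim : Filter.Tendsto a Filter.atTop (nhds 0) := by
    have h := (has.tendsto_atTop_zero).rpow_const (p := (N : ℝ)⁻¹) (Or.inr (by positivity))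
    rw [Real.zero_rpow (by positivity)] at h
    refine h.congr fun n => ?_
    exact Real.pow_rpow_inv_natCast (ha0 n) hN
  have hlim : Filter.Tendsto (fun K => ∑' n, e K n) Filter.atTop (nhds (∑' _ : ℕ, (0 : ℝ))) := by
    refine tendsto_tsum_of_dominated_convergence hbound (fun n => ?_)
      (Filter.Eventually.of_forall fun K n => hle K n)
    have hmax : Filter.Tendsto (fun K => max K (n / 2 / 2)) Filter.atTop Filter.atTop :=
      Filter.tendsto_atTop_mono (fun K => le_max_left _ _) Filter.tendsto_id
    have h := ((((ha_lim.comp hmax).pow k).const_mul M).mul_const (M * a (n / 2 / 2) ^ l))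
    -- Here `k ≠ 0` matters: the factor coming from `A - R K` must tend to `0`.
    rw [zero_pow hk, mul_zero, zero_mul] at h
    exact h
  rw [tsum_zero] at hlim
  have hlim' := hlim.const_mul 28
  rw [mul_zero] at hlim'
  have h0 := ge_of_tendsto' hlim' hdiff
  exact sub_eq_zero.1 (norm_le_zero_iff.1 h0)

end Trace

theorem Chain.compAt_zero_cons_cons {C : Type u} [Category.{v} C] {n : ℕ} {W X Y Z : C}
    (f : Y ⟶ Z) (g : X ⟶ Y) (c : Chain C n W X) :
    Chain.compAt 0 (.cons f (.cons g c)) = .cons (g ≫ f) c := by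
  cases n <;> rfl

/-! ### Parity and the derivation `[ℱ, -]` on words -/

namespace FredholmPair

variable {C : Type u} [Category.{v} C] [Preadditive C] [Linear ℂ C] (P : FredholmPair.{w} C)

/-- The grading operator of `ℋ(X)`. -/
abbrev eps (X : C) : P.H X →L[ℂ] P.H X := (P.functor.obj X).ε

theorem eps_op {X Y : C} (f : X ⟶ Y) : P.eps Y ∘L P.op f = P.op f ∘L P.eps X :=
  P.map_even f

theorem eps_comm {X Y : C} (f : X ⟶ Y) : P.eps Y ∘L P.comm f = -(P.comm f ∘L P.eps X) := by
  have h1 : P.eps Y ∘L (P.F Y ∘L P.op f) = -((P.F Y ∘L P.op f) ∘L P.eps X) := by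
    rw [← ContinuousLinearMap.comp_assoc, P.F_odd Y, ContinuousLinearMap.neg_comp,
      ContinuousLinearMap.comp_assoc, eps_op, ContinuousLinearMap.comp_assoc]
  have h2 : P.eps Y ∘L (P.op f ∘L P.F X) = -((P.op f ∘L P.F X) ∘L P.eps X) := by
    rw [← ContinuousLinearMap.comp_assoc, eps_op, ContinuousLinearMap.comp_assoc, P.F_odd X,
      ContinuousLinearMap.comp_neg, ContinuousLinearMap.comp_assoc]
  rw [comm, ContinuousLinearMap.comp_sub, h1, h2, ContinuousLinearMap.sub_comp]
  abel

theorem eps_commProd : ∀ {j : ℕ} {X Y : C} (c : Chain C j X Y),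
    P.eps Y ∘L P.commProd c = (-1 : ℂ) ^ j • (P.commProd c ∘L P.eps X)
  | _, _, _, .nil X => by
      simp [commProd, ContinuousLinearMap.id_comp, ContinuousLinearMap.comp_id]
  | _, _, _, .cons f c => by
      rw [commProd, ← ContinuousLinearMap.comp_assoc, eps_comm, ContinuousLinearMap.neg_comp,
        ContinuousLinearMap.comp_assoc, eps_commProd c, ContinuousLinearMap.comp_smul,
        ContinuousLinearMap.comp_assoc, pow_succ, mul_neg_one, neg_smul]

theorem eps_omegaHom {j : ℕ} {X Y : C} {T : P.H X →L[ℂ] P.H Y} (hT : T ∈ P.omegaHom j X Y) :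
    P.eps Y ∘L T = (-1 : ℂ) ^ j • (T ∘L P.eps X) := by
  refine P.omegaHom_induction (p := fun T => P.eps Y ∘L T = (-1 : ℂ) ^ j • (T ∘L P.eps X))
    ?_ ?_ ?_ ?_ hT
  · intro X₁ f c
    rw [← ContinuousLinearMap.comp_assoc, eps_op, ContinuousLinearMap.comp_assoc, eps_commProd,
      ContinuousLinearMap.comp_smul, ContinuousLinearMap.comp_assoc]
  · rw [ContinuousLinearMap.comp_zero, ContinuousLinearMap.zero_comp, smul_zero]
  · intro S T hS hT
    rw [ContinuousLinearMap.comp_add, hS, hT, ContinuousLinearMap.add_comp, smul_add]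
  · intro a T hT
    rw [ContinuousLinearMap.comp_smul, hT, ContinuousLinearMap.smul_comp, smul_comm]

theorem comm_comp {X Y Z : C} (f : Y ⟶ Z) (g : X ⟶ Y) :
    P.comm (g ≫ f) = P.comm f ∘L P.op g + P.op f ∘L P.comm g := by
  simp only [comm, op_comp, ContinuousLinearMap.comp_sub, ContinuousLinearMap.sub_comp,
    ContinuousLinearMap.comp_assoc]
  abel

theorem comm_add {X Y : C} (f g : X ⟶ Y) : P.comm (f + g) = P.comm f + P.comm g := by
  simp only [comm, op_add, ContinuousLinearMap.comp_add, ContinuousLinearMap.add_comp]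
  abel

theorem comm_smul {X Y : C} (a : ℂ) (f : X ⟶ Y) : P.comm (a • f) = a • P.comm f := by
  simp only [comm, op_smul, ContinuousLinearMap.comp_smul, ContinuousLinearMap.smul_comp,
    smul_sub]

/-- Commutators graded-commute with `ℱ`, so the differential only acts on the leading `ℋ(f)`. -/
theorem gradedComm_op_comp_commProd {j : ℕ} {X Y Z : C} (f : Y ⟶ Z) (c : Chain C j X Y) :
    P.gradedComm j (P.op f ∘L P.commProd c) = P.commProd (.cons f c) := by
  change P.F Z ∘L (P.op f ∘L P.commProd c)
    - (-1 : ℂ) ^ j • ((P.op f ∘L P.commProd c) ∘L P.F X) = _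
  rw [commProd, comm, ContinuousLinearMap.comp_assoc (P.op f), ← ContinuousLinearMap.comp_smul,
    ← F_commProd, ContinuousLinearMap.sub_comp, ContinuousLinearMap.comp_assoc,
    ContinuousLinearMap.comp_assoc]

theorem F_gradedComm (i : ℕ) {X Y : C} (T : P.H X →L[ℂ] P.H Y) :
    P.F Y ∘L P.gradedComm i T = (-1 : ℂ) ^ (i + 1) • (P.gradedComm i T ∘L P.F X) :=
  sub_eq_zero.1 (P.gradedComm_gradedComm i T)

theorem comm_mem_omegaHom {X Y : C} (f : X ⟶ Y) : P.comm f ∈ P.omegaHom 1 X Y := by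
  have h := P.commProd_mem (.cons f (.nil X))
  rwa [commProd, commProd, ContinuousLinearMap.comp_id] at h

theorem op_mem_omegaHom {X Y : C} (f : X ⟶ Y) : P.op f ∈ P.omegaHom 0 X Y :=
  Submodule.subset_span ⟨f, rfl⟩

theorem commProd_unsnoc : ∀ {n : ℕ} {X Y : C} (c : Chain C (n + 1) X Y),
    P.commProd c = P.commProd c.unsnoc.2.2 ∘L P.comm c.unsnoc.2.1
  | 0, _, _, .cons _ (.nil _) =>
      (ContinuousLinearMap.comp_id _).trans (ContinuousLinearMap.id_comp _).symm
  | _ + 1, _, _, .cons f c =>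
      (congrArg (P.comm f ∘L ·) (commProd_unsnoc c)).trans
        (ContinuousLinearMap.comp_assoc _ _ _).symm

/-- The alternating sum of the inner faces telescopes, as `[ℱ, -]` is a derivation. -/
theorem sum_commProd_compAt : ∀ {n : ℕ} {X Y Z : C} (f : Z ⟶ Y) (c : Chain C (n + 1) X Z),
    ∑ i : Fin (n + 1), (-1 : ℂ) ^ (i : ℕ) • P.commProd (Chain.compAt i (.cons f c)) =
      P.op f ∘L P.commProd c +
        (-1 : ℂ) ^ n • ((P.comm f ∘L P.commProd c.unsnoc.2.2) ∘L P.op c.unsnoc.2.1)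
  | 0, _, _, _, f, .cons g (.nil _) => by
      change ∑ i : Fin 1, _ = P.op f ∘L (P.comm g ∘L ContinuousLinearMap.id ℂ _) +
        (-1 : ℂ) ^ 0 • ((P.comm f ∘L ContinuousLinearMap.id ℂ _) ∘L P.op g)
      rw [Fin.sum_univ_one]
      change (-1 : ℂ) ^ 0 • (P.comm (g ≫ f) ∘L ContinuousLinearMap.id ℂ _) = _
      simp only [pow_zero, one_smul, ContinuousLinearMap.comp_id, comm_comp]
      rw [add_comm]
  | n + 1, _, _, _, f, .cons g c => by
      change _ = P.op f ∘L P.commProd (.cons g c) + (-1 : ℂ) ^ (n + 1) •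
        ((P.comm f ∘L (P.comm g ∘L P.commProd c.unsnoc.2.2)) ∘L P.op c.unsnoc.2.1)
      have ih := sum_commProd_compAt g c
      change _ = P.op g ∘L P.commProd c + (-1 : ℂ) ^ n •
        ((P.comm g ∘L P.commProd c.unsnoc.2.2) ∘L P.op c.unsnoc.2.1) at ih
      -- All faces but the `0`-th leave `f` alone, so the induction hypothesis applies behind `[ℱ,
      -- f]`; its first end term cancels half of `[ℱ, fg] = [ℱ, f] g + f [ℱ, g]`.
      have hsucc : ∀ i : Fin (n + 1), P.commProd (Chain.compAt i.succ (.cons f (.cons g c))) =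
          P.comm f ∘L P.commProd (Chain.compAt i (.cons g c)) := fun _ => rfl
      rw [Fin.sum_univ_succ]
      simp only [hsucc, Fin.val_zero, pow_zero, one_smul, Fin.val_succ, pow_succ (-1 : ℂ),
        mul_neg_one, neg_smul, Finset.sum_neg_distrib]
      simp only [← ContinuousLinearMap.comp_smul]
      have hsum : ∑ i : Fin (n + 1),
          P.comm f ∘L ((-1 : ℂ) ^ (i : ℕ) • P.commProd (Chain.compAt i (.cons g c))) =
          P.comm f ∘L ∑ i : Fin (n + 1),
            ((-1 : ℂ) ^ (i : ℕ) • P.commProd (Chain.compAt i (.cons g c))) := by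
        ext x
        simp [map_sum]
      rw [hsum, ih]
      simp only [Chain.compAt_zero_cons_cons, commProd, comm_comp,
        ContinuousLinearMap.comp_add, ContinuousLinearMap.add_comp,
        ContinuousLinearMap.comp_smul, ContinuousLinearMap.comp_assoc]
      abel

/-! ### The trace `½ Tr(ε ℱ T)` in odd degree -/

section Trace

variable {P} {N : ℕ}

theorem powApprox_commProd (hN : N ≠ 0)
    (hP : ∀ {X Y : C} (f : X ⟶ Y), PowApprox N 1 (P.comm f))
    {n : ℕ} {X Y : C} (c : Chain C n X Y) : PowApprox N n (P.commProd c) := by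
  induction c with
  | nil X => exact powApprox_bounded hN _
  | @cons n X Y Z f c ih =>
    have h := (hP f).comp ih
    rw [Nat.add_comm 1 n] at h
    exact h

theorem powApprox_omegaHom (hN : N ≠ 0)
    (hP : ∀ {X Y : C} (f : X ⟶ Y), PowApprox N 1 (P.comm f)) {j : ℕ} {X Y : C}
    {T : P.H X →L[ℂ] P.H Y} (hT : T ∈ P.omegaHom j X Y) : PowApprox N j T :=
  P.omegaHom_induction (p := fun T => PowApprox N j T)
    (fun _ c => (powApprox_commProd hN hP c).bounded_comp hN _) (powApprox_zero_op hN j)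
    (fun _ _ hS hT => hS.add hT) (fun a _ hT => hT.smul a) hT

/-- In positive degree every generator contains a compact factor `[ℱ, g]`. -/
theorem isCompactOperator_omegaHom
    (hP : ∀ {X Y : C} (f : X ⟶ Y), IsCompactOperator (P.comm f)) {j : ℕ} {X Y : C}
    {T : P.H X →L[ℂ] P.H Y} (hT : T ∈ P.omegaHom (j + 1) X Y) : IsCompactOperator T := by
  refine P.omegaHom_induction (p := fun T => IsCompactOperator T) ?_ ?_ ?_ ?_ hT
  · intro X₁ f c
    cases c with
    | cons g c => exact ((hP g).comp_clm (P.commProd c)).clm_comp (P.op f)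
  · exact isCompactOperator_zero
  · exact fun _ _ hS hT => hS.add hT
  · exact fun a _ hT => hT.smul a

/-- The functional `T ↦ Tr(ε ℱ T)` is a trace for graded operators of odd total degree. -/
theorem trace_eps_F_comp_comm (hN : Odd N) {k l : ℕ} (hk : k ≠ 0) (hkl : k + l = N) {X Y : C}
    {S : P.H Y →L[ℂ] P.H X} {T : P.H X →L[ℂ] P.H Y} (hS : PowApprox N k S)
    (hT : PowApprox N l T) (hF : P.F X ∘L S = (-1 : ℂ) ^ k • (S ∘L P.F Y))
    (hε : P.eps Y ∘L T = (-1 : ℂ) ^ l • (T ∘L P.eps X)) :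
    trace (P.eps X ∘L P.F X ∘L (S ∘L T)) = trace (P.eps Y ∘L P.F Y ∘L (T ∘L S)) := by
  have hN0 : N ≠ 0 := by rintro rfl; simp at hN
  have hε' : T ∘L P.eps X = (-1 : ℂ) ^ l • (P.eps Y ∘L T) := by
    rw [hε, smul_smul, ← mul_pow]; simp
  have h1 : trace ((P.eps X ∘L P.F X ∘L S) ∘L T) = trace (T ∘L (P.eps X ∘L P.F X ∘L S)) :=
    trace_comp_comm hk hkl ((hS.bounded_comp hN0 _).bounded_comp hN0 _) hT
  have hTS : PowApprox N N (P.eps Y ∘L T ∘L S) := by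
    have := (hT.comp hS).bounded_comp hN0 (P.eps Y)
    rwa [add_comm l k, hkl] at this
  -- A second exchange brings `ℱ` back to the front; it is only bounded, so all of the exponent `N`
  -- sits on the other factor.
  have h2 : trace ((P.eps Y ∘L T ∘L S) ∘L P.F Y) = trace (P.F Y ∘L (P.eps Y ∘L T ∘L S)) :=
    trace_comp_comm hN0 (add_zero N) hTS (powApprox_bounded hN0 _)
  -- Passing `ℱ` through `S` and `ε` through `T` costs `(-1)^(k + l) = -1`. The anticommutation of
  -- `ε` and `ℱ` in `h4` restores the sign.
  have h3 : T ∘L (P.eps X ∘L P.F X ∘L S) = -((P.eps Y ∘L T ∘L S) ∘L P.F Y) := by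
    rw [hF, ← ContinuousLinearMap.comp_assoc, hε', ContinuousLinearMap.comp_smul,
      ContinuousLinearMap.smul_comp, smul_smul, ← pow_add, hkl, hN.neg_one_pow, neg_one_smul]
    simp only [ContinuousLinearMap.comp_assoc]
  have h4 : P.F Y ∘L (P.eps Y ∘L T ∘L S) = -(P.eps Y ∘L P.F Y ∘L (T ∘L S)) := by
    rw [← ContinuousLinearMap.comp_assoc, ← neg_eq_iff_eq_neg.2 (P.F_odd Y),
      ContinuousLinearMap.neg_comp, ContinuousLinearMap.comp_assoc]
  simp only [ContinuousLinearMap.comp_assoc] at h1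
  simp only [ContinuousLinearMap.comp_assoc] at h3
  rw [h1, h3, trace_neg]
  simp only [ContinuousLinearMap.comp_assoc] at h2
  rw [h2, h4, trace_neg, neg_neg]

variable (hP : ∀ {X Y : C} (f : X ⟶ Y), PowApprox N 1 (P.comm f))

/-- The linear form `T ↦ ½ Tr(ε ℱ T)` on the operators of degree `N`. -/
def oddTrace (hN : N ≠ 0) (X : C) : P.omegaHom N X X →ₗ[ℂ] ℂ where
  toFun T := 1 / 2 * trace (P.eps X ∘L P.F X ∘L T.1)
  map_add' S T := by
    have h : ∀ T : P.omegaHom N X X, TraceClass (P.eps X ∘L P.F X ∘L T.1) := fun T =>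
      (((powApprox_omegaHom hN hP T.2).bounded_comp hN _).bounded_comp hN _).traceClass
    rw [Submodule.coe_add, ContinuousLinearMap.comp_add, ContinuousLinearMap.comp_add,
      trace_add (h S) (h T), mul_add]
  map_smul' a T := by
    rw [Submodule.coe_smul, ContinuousLinearMap.comp_smul, ContinuousLinearMap.comp_smul,
      trace_smul, RingHom.id_apply, smul_eq_mul, mul_left_comm]

theorem oddTrace_comp_comm (hN : Odd N) (hN0 : N ≠ 0) {k l : ℕ} (hk : k ≠ 0) (hkl : k + l = N)
    {X Y : C} {S : P.H Y →L[ℂ] P.H X} {T : P.H X →L[ℂ] P.H Y} (hS : S ∈ P.omegaHom k Y X)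
    (hT : T ∈ P.omegaHom l X Y) (hF : P.F X ∘L S = (-1 : ℂ) ^ k • (S ∘L P.F Y)) :
    oddTrace hP hN0 X ⟨S ∘L T, P.omegaHom_comp_mem hkl hS hT⟩ =
      oddTrace hP hN0 Y ⟨T ∘L S, P.omegaHom_comp_mem ((add_comm l k).trans hkl) hT hS⟩ :=
  congrArg (1 / 2 * ·) (trace_eps_F_comp_comm hN hk hkl (powApprox_omegaHom hN0 hP hS)
    (powApprox_omegaHom hN0 hP hT) hF (P.eps_omegaHom hT))

end Trace

/-- The functional `L` is arbitrary so that the induction can precompose it with left multiplication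
by `[ℱ, f]`. -/
theorem isMultilinear_commProd : ∀ {n : ℕ} {X Y : C} (L : P.omegaHom n X Y →ₗ[ℂ] ℂ),
    IsMultilinear fun c : Chain C n X Y => L ⟨P.commProd c, P.commProd_mem c⟩
  | 0, _, _, _ => trivial
  | n + 1, X, Y, L => fun Z => by
      refine ⟨fun c => ⟨fun f g => ?_, fun a f => ?_⟩, fun f => ?_⟩
      · rw [← map_add]
        refine congrArg L (Subtype.ext ?_)
        simp only [commProd, Submodule.coe_add, comm_add, ContinuousLinearMap.add_comp]
      · rw [← map_smul]
        refine congrArg L (Subtype.ext ?_)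
        simp only [commProd, Submodule.coe_smul, comm_smul, ContinuousLinearMap.smul_comp]
      · let M : P.omegaHom n X Z →ₗ[ℂ] P.omegaHom (n + 1) X Y :=
          { toFun := fun T => ⟨P.comm f ∘L T.1, P.comm_comp_mem f T.2⟩
            map_add' := fun S T => Subtype.ext (ContinuousLinearMap.comp_add _ _ _)
            map_smul' := fun a T => Subtype.ext (ContinuousLinearMap.comp_smul _ _ _) }
        exact isMultilinear_commProd (L ∘ₗ M)

/-! ### The character as a cyclic cocycle -/

section Cocycle

variable {P} {m : ℕ}

/-- Applying `∂'` puts `f⁰` on the same footing as the other entries; both cyclicity and the cocycle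
identity are read off this symmetric form. -/
theorem phi_eq_oddTrace
    (hP : ∀ {X Y : C} (f : X ⟶ Y), PowApprox (2 * m + 1) 1 (P.comm f))
    (c : CyclicChain C (2 * m)) :
    P.phi m c = oddTrace hP (Nat.succ_ne_zero _) c.1 ⟨P.commProd c.2, P.commProd_mem c.2⟩ := by
  obtain ⟨X, c⟩ := c
  cases c with
  | cons f c =>
    change P.superTrace (2 * m) (P.op f ∘L P.commProd c) = _
    rw [superTrace, gradedComm_op_comp_commProd]
    rfl

theorem phi_mem_cochains
    (hP : ∀ {X Y : C} (f : X ⟶ Y), PowApprox (2 * m + 1) 1 (P.comm f)) :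
    P.phi m ∈ cochains C (2 * m) := by
  intro X
  have h := P.isMultilinear_commProd (oddTrace hP (Nat.succ_ne_zero _) X)
  exact (funext fun c => phi_eq_oddTrace hP ⟨X, c⟩ :
    (fun c => P.phi m ⟨X, c⟩) = _) ▸ h

end Cocycle

end FredholmPair

theorem CyclicChain.lastFace_cons {C : Type u} [Category.{v} C] {n : ℕ} {X Z : C} (f : Z ⟶ X)
    (c : Chain C (n + 1) X Z) : CyclicChain.lastFace ⟨X, .cons f c⟩ =
      ⟨c.unsnoc.1, .cons (f ≫ c.unsnoc.2.1) c.unsnoc.2.2⟩ :=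
  congrArg (Sigma.mk c.unsnoc.1) (Chain.compAt_zero_cons_cons c.unsnoc.2.1 f c.unsnoc.2.2)

namespace FredholmPair

variable {C : Type u} [Category.{v} C] [Preadditive C] [Linear ℂ C] {P : FredholmPair.{w} C}

theorem oddTrace_congr {N : ℕ} (hP : ∀ {X Y : C} (f : X ⟶ Y), PowApprox N 1 (P.comm f))
    (hN : N ≠ 0) {X : C} {S T : P.H X →L[ℂ] P.H X} (h : S = T) (hS : S ∈ P.omegaHom N X X)
    (hT : T ∈ P.omegaHom N X X) : oddTrace hP hN X ⟨S, hS⟩ = oddTrace hP hN X ⟨T, hT⟩ := by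
  subst h
  rfl

theorem oddTrace_add_smul {N : ℕ} (hP : ∀ {X Y : C} (f : X ⟶ Y), PowApprox N 1 (P.comm f))
    (hN : N ≠ 0) {X : C} {S T : P.H X →L[ℂ] P.H X} (hS : S ∈ P.omegaHom N X X)
    (hT : T ∈ P.omegaHom N X X) (a : ℂ) :
    oddTrace hP hN X ⟨S + a • T, add_mem hS (Submodule.smul_mem _ a hT)⟩ =
      oddTrace hP hN X ⟨S, hS⟩ + a * oddTrace hP hN X ⟨T, hT⟩ := by
  rw [← smul_eq_mul, ← map_smul, ← map_add]
  rfl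

variable {m : ℕ}

theorem cyclicLambda_phi
    (hP : ∀ {X Y : C} (f : X ⟶ Y), PowApprox (2 * m + 1) 1 (P.comm f)) :
    cyclicLambda (2 * m) (P.phi m) = P.phi m := by
  funext c
  change (-1 : ℂ) ^ (2 * m) * P.phi m c.rotate = P.phi m c
  rw [(even_two_mul m).neg_one_pow, one_mul, phi_eq_oddTrace hP, phi_eq_oddTrace hP]
  refine (oddTrace_comp_comm hP (odd_two_mul_add_one m) (Nat.succ_ne_zero _) one_ne_zero
    (add_comm 1 (2 * m)) (P.comm_mem_omegaHom c.2.unsnoc.2.1) (P.commProd_mem c.2.unsnoc.2.2)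
    ?_).trans (oddTrace_congr hP _ (P.commProd_unsnoc c.2).symm _ _)
  rw [F_comm, pow_one, neg_one_smul]

theorem phi_cons_comp (hP : ∀ {X Y : C} (f : X ⟶ Y), PowApprox (2 * m + 1) 1 (P.comm f))
    (hN : 2 * m + 1 ≠ 0) {X Z W : C} (f : Z ⟶ X) (g : X ⟶ W) (d : Chain C (2 * m) W Z) :
    P.phi m ⟨W, .cons (f ≫ g) d⟩ =
      oddTrace hP hN W ⟨P.comm g ∘L (P.op f ∘L P.commProd d),
        P.comm_comp_mem g (P.op_comp_commProd_mem f d)⟩ +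
      oddTrace hP hN W ⟨P.op g ∘L P.commProd (.cons f d), P.op_comp_commProd_mem g _⟩ := by
  refine (phi_eq_oddTrace hP _).trans (Eq.trans (congrArg (oddTrace hP hN W) (Subtype.ext ?_))
    (map_add (oddTrace hP hN W) _ _))
  change P.comm (f ≫ g) ∘L P.commProd d = P.comm g ∘L (P.op f ∘L P.commProd d) +
    P.op g ∘L (P.comm f ∘L P.commProd d)
  rw [comm_comp, ContinuousLinearMap.add_comp, ContinuousLinearMap.comp_assoc,
    ContinuousLinearMap.comp_assoc]

theorem sum_phi_face_cons
    (hP : ∀ {X Y : C} (f : X ⟶ Y), PowApprox (2 * m + 1) 1 (P.comm f))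
    (hN : 2 * m + 1 ≠ 0) {X Z : C} (f : Z ⟶ X) (c : Chain C (2 * m + 1) X Z) :
    ∑ i : Fin (2 * m + 1), (-1 : ℂ) ^ (i : ℕ) * P.phi m (CyclicChain.face i ⟨X, .cons f c⟩) =
      oddTrace hP hN X ⟨P.op f ∘L P.commProd c, P.op_comp_commProd_mem f c⟩ +
      oddTrace hP hN X ⟨P.commProd (.cons f c.unsnoc.2.2) ∘L P.op c.unsnoc.2.1,
        P.omegaHom_comp_mem (add_zero _) (P.commProd_mem _) (P.op_mem_omegaHom _)⟩ := by
  have h : ∀ i : Fin (2 * m + 1), (-1 : ℂ) ^ (i : ℕ) *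
      P.phi m (CyclicChain.face i ⟨X, .cons f c⟩) =
      oddTrace hP hN X ((-1 : ℂ) ^ (i : ℕ) •
        ⟨P.commProd (Chain.compAt i (.cons f c)), P.commProd_mem _⟩) := by
    intro i
    rw [map_smul, smul_eq_mul, phi_eq_oddTrace hP]
    rfl
  rw [Finset.sum_congr rfl fun i _ => h i, ← map_sum, ← map_add]
  refine congrArg _ (Subtype.ext ?_)
  rw [Submodule.coe_sum]
  refine (P.sum_commProd_compAt f c).trans ?_
  rw [(even_two_mul m).neg_one_pow, one_smul]
  rfl

/-- The inner faces leave `τ(f [ℱ, c]) + τ([ℱ, f] [ℱ, d] g)`, where `c` ends in `g` preceded by `d`.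
By Leibniz the last face gives the same two terms up to cyclic exchange, with sign `(-1)^(2m+1) =
-1`. -/
theorem hochschildB_phi
    (hP : ∀ {X Y : C} (f : X ⟶ Y), PowApprox (2 * m + 1) 1 (P.comm f)) :
    hochschildB (2 * m) (P.phi m) = 0 := by
  funext ⟨X, c⟩
  cases c with
  | @cons _ _ _ Z f c =>
  have hN : 2 * m + 1 ≠ 0 := Nat.succ_ne_zero _
  have hodd : Odd (2 * m + 1) := odd_two_mul_add_one m
  change (∑ i : Fin (2 * m + 1), (-1 : ℂ) ^ (i : ℕ) *
      P.phi m (CyclicChain.face i ⟨X, .cons f c⟩)) +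
    (-1 : ℂ) ^ (2 * m + 1) * P.phi m (CyclicChain.lastFace ⟨X, .cons f c⟩) = 0
  have hc := P.commProd_unsnoc c
  rw [sum_phi_face_cons hP hN, CyclicChain.lastFace_cons, hodd.neg_one_pow]
  generalize c.unsnoc = q at hc ⊢
  obtain ⟨W, g, d⟩ := q
  rw [phi_cons_comp hP hN]
  have hF : P.F W ∘L P.comm g = (-1 : ℂ) ^ 1 • (P.comm g ∘L P.F X) := by
    rw [F_comm, pow_one, neg_one_smul]
  have h1 := oddTrace_comp_comm hP hodd hN one_ne_zero (add_comm 1 (2 * m))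
    (P.comm_mem_omegaHom g) (P.op_comp_commProd_mem f d) hF
  have h2 := oddTrace_comp_comm hP hodd hN hN (add_zero _) (P.commProd_mem (.cons f d))
    (P.op_mem_omegaHom g) (P.F_commProd (.cons f d))
  have h3 := oddTrace_congr hP hN (S := P.op f ∘L P.commProd c)
    (T := (P.op f ∘L P.commProd d) ∘L P.comm g)
    (by rw [hc, ContinuousLinearMap.comp_assoc]) (P.op_comp_commProd_mem f c)
    (P.omegaHom_comp_mem rfl (P.op_comp_commProd_mem f d) (P.comm_mem_omegaHom g))
  rw [h3, ← h1, h2]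
  ring

theorem phi_mem_cyclicCocycles
    (hP : ∀ {X Y : C} (f : X ⟶ Y), PowApprox (2 * m + 1) 1 (P.comm f)) :
    P.phi m ∈ cyclicCocycles C (2 * m) := by
  refine ⟨⟨phi_mem_cochains hP, ?_⟩, hochschildB_phi hP⟩
  rw [SetLike.mem_coe, LinearMap.mem_ker, LinearMap.sub_apply, cyclicLambda_phi hP,
    LinearMap.id_apply, sub_self]

/-! ### The closed graded trace and its cycle -/

theorem superTrace_comp_comm
    (hP : ∀ {X Y : C} (f : X ⟶ Y), PowApprox (2 * m + 1) 1 (P.comm f)) {i j : ℕ}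
    (h : i + j = 2 * m) {X Y : C} {g : P.H Y →L[ℂ] P.H X} {g' : P.H X →L[ℂ] P.H Y}
    (hg : g ∈ P.omegaHom i Y X) (hg' : g' ∈ P.omegaHom j X Y) :
    P.superTrace (2 * m) (g ∘L g') = (-1) ^ (i * j) * P.superTrace (2 * m) (g' ∘L g) := by
  have hN : 2 * m + 1 ≠ 0 := Nat.succ_ne_zero _
  have hodd : Odd (2 * m + 1) := odd_two_mul_add_one m
  have expand : ∀ {i j : ℕ} (_ : i + j = 2 * m) {X Y : C} {g : P.H Y →L[ℂ] P.H X}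
      {g' : P.H X →L[ℂ] P.H Y} (hg : g ∈ P.omegaHom i Y X) (hg' : g' ∈ P.omegaHom j X Y),
      P.superTrace (2 * m) (g ∘L g') =
        oddTrace hP hN X ⟨P.gradedComm i g ∘L g',
          P.omegaHom_comp_mem (by omega) (P.gradedComm_mem rfl hg) hg'⟩ +
        (-1 : ℂ) ^ i * oddTrace hP hN X ⟨g ∘L P.gradedComm j g',
          P.omegaHom_comp_mem (by omega) hg (P.gradedComm_mem rfl hg')⟩ := by
    intro i j h X Y g g' hg hg'
    have hd : P.gradedComm (2 * m) (g ∘L g') =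
        P.gradedComm i g ∘L g' + (-1 : ℂ) ^ i • (g ∘L P.gradedComm j g') :=
      h ▸ P.gradedComm_comp i j g g'
    have hA : P.gradedComm i g ∘L g' ∈ P.omegaHom (2 * m + 1) X X :=
      P.omegaHom_comp_mem (by omega) (P.gradedComm_mem rfl hg) hg'
    have hB : g ∘L P.gradedComm j g' ∈ P.omegaHom (2 * m + 1) X X :=
      P.omegaHom_comp_mem (by omega) hg (P.gradedComm_mem rfl hg')
    rw [← oddTrace_add_smul hP hN hA hB, superTrace, hd]
    rfl
  -- Only one factor must graded-commute with `ℱ`, and `∂'g` and `∂'g'` do, by `∂'² = 0`.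
  have h1 := oddTrace_comp_comm hP hodd hN i.succ_ne_zero (by omega : i + 1 + j = 2 * m + 1)
    (P.gradedComm_mem rfl hg) hg' (P.F_gradedComm i g)
  have h2 := oddTrace_comp_comm hP hodd hN j.succ_ne_zero (by omega : j + 1 + i = 2 * m + 1)
    (P.gradedComm_mem rfl hg') hg (P.F_gradedComm j g')
  rw [expand h hg hg', expand ((add_comm j i).trans h) hg' hg, h1, h2]
  -- As `i` and `j` have equal parity, the signs `(-1)^i`, `(-1)^j` and `(-1)^(ij)` coincide.
  have hpar : Even (i + j) := h ▸ even_two_mul m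
  rcases Nat.even_or_odd i with hi | hi
  · have hj : Even j := (Nat.even_add.1 hpar).1 hi
    rw [hi.neg_one_pow, hj.neg_one_pow, (hi.mul_right j).neg_one_pow]
    ring
  · have hj : Odd j := by
      rw [← Nat.not_even_iff_odd] at hi ⊢
      exact fun hj => hi ((Nat.even_add.1 hpar).2 hj)
    rw [hi.neg_one_pow, hj.neg_one_pow, (hi.mul hj).neg_one_pow]
    ring

/-- The closed graded trace `Tr_s` on `Ω_{(ℋ, ℱ)} C`. -/
def closedSuperTrace (hP : ∀ {X Y : C} (f : X ⟶ Y), PowApprox (2 * m + 1) 1 (P.comm f)) :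
    ClosedGradedTrace P.Omega (2 * m) where
  tr X := oddTrace hP (Nat.succ_ne_zero _) X ∘ₗ P.Omega.d (X := X) (Y := X) rfl
  closed {_} h X f :=
    (congrArg (oddTrace hP (Nat.succ_ne_zero _) X) (P.Omega.d_d h rfl f)).trans
      (map_zero (oddTrace hP (Nat.succ_ne_zero _) X))
  graded h _ _ _ g g' := superTrace_comp_comm hP h g.2 g'.2

theorem rho_dWord : ∀ {n : ℕ} {X Y : C} (c : Chain C (n + 1) X Y),
    (P.rho.dWord c : P.omegaHom (n + 1) X Y).1 = P.commProd c
  | 0, _, _, .cons f (.nil _) => by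
      change P.gradedComm 0 (P.op f) = P.comm f ∘L ContinuousLinearMap.id ℂ _
      rw [ContinuousLinearMap.comp_id, comm]
      change P.F _ ∘L P.op f - (-1 : ℂ) ^ 0 • (P.op f ∘L P.F _) = _
      rw [pow_zero, one_smul]
  | n + 1, _, _, .cons f c => by
      change P.gradedComm 0 (P.op f) ∘L (P.rho.dWord c : P.omegaHom (n + 1) _ _).1 =
        P.comm f ∘L P.commProd c
      rw [rho_dWord c, comm]
      change (P.F _ ∘L P.op f - (-1 : ℂ) ^ 0 • (P.op f ∘L P.F _)) ∘L _ = _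
      rw [pow_zero, one_smul]
      rfl

theorem rho_word {n : ℕ} {X Y Z : C} (f : Z ⟶ Y) (c : Chain C n X Z) :
    (P.rho.word (.cons f c) : P.omegaHom n X Y).1 = P.op f ∘L P.commProd c := by
  cases n with
  | zero =>
    cases c
    exact (ContinuousLinearMap.comp_id _).symm
  | succ n => exact congrArg (P.op f ∘L ·) (rho_dWord c)

theorem character_closedSuperTrace
    (hP : ∀ {X Y : C} (f : X ⟶ Y), PowApprox (2 * m + 1) 1 (P.comm f)) :
    (Cycle.mk P.Omega (closedSuperTrace hP) P.rho).character = P.phi m := by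
  funext ⟨X, c⟩
  cases c with
  | cons f c => exact congrArg (P.superTrace (2 * m)) (rho_word f c)

end FredholmPair

end FredholmCat

end

theorem theorem6p6 {C : Type u} [CategoryTheory.Category.{v} C] [CategoryTheory.Preadditive C]
    [CategoryTheory.Linear ℂ C] (P : FredholmCat.FredholmPair.{w} C) (p : ℝ) (hp : 1 ≤ p)
    (hP : P.IsSummable p) (m : ℕ) (hm : p - 1 ≤ 2 * (m : ℝ)) :
    (∀ (X : C) (T : P.Omega.Hom (2 * m) X X),
      FredholmCat.IsSchatten 1 (P.gradedComm (2 * m) T.1)) ∧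
    ∃ Trs : FredholmCat.ClosedGradedTrace P.Omega (2 * m),
      (∀ (X : C) (T : P.Omega.Hom (2 * m) X X), Trs.tr X T = P.superTrace (2 * m) T.1) ∧
      (FredholmCat.Cycle.mk P.Omega Trs P.rho).character = P.phi m ∧
      ∃ hφ : P.phi m ∈ FredholmCat.cyclicCocycles C (2 * m),
        P.chern m = Submodule.Quotient.mk ⟨P.phi m, hφ⟩ := by
  -- The bound `2m ≥ p - 1` enters only here: `2m + 1` commutators suffice for trace class.
  have hN : p ≤ ((2 * m + 1 : ℕ) : ℝ) := by
    push_cast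
    linarith
  have hS : ∀ {X Y : C} (f : X ⟶ Y), FredholmCat.PowApprox (2 * m + 1) 1 (P.comm f) :=
    fun f => (hP f).powApprox hp hN
  have hφ := FredholmCat.FredholmPair.phi_mem_cyclicCocycles hS
  refine ⟨fun X T => ?_, FredholmCat.FredholmPair.closedSuperTrace hS, fun X T => rfl,
    FredholmCat.FredholmPair.character_closedSuperTrace hS, hφ, dif_pos hφ⟩
  have hT : P.gradedComm (2 * m) T.1 ∈ P.omegaHom (2 * m + 1) X X := P.gradedComm_mem rfl T.2
  have hA := FredholmCat.FredholmPair.powApprox_omegaHom (Nat.succ_ne_zero _) hS hT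
  exact hA.traceClass.isSchatten
    (FredholmCat.FredholmPair.isCompactOperator_omegaHom (fun f => (hP f).1) hT)
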